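/- Let $k$ be a field, let $n\ge 2$ and $R=k[x_1,\dots,x_n]$. Let $F=\{\mathbf x^{v_1},\dots,\mathbf x^{v_n}\}\subset R$ be a set of $n$ distinct monomials of degree $2$ that satisfies the canonical restrictions (the monomials have no nontrivial common factor, and every variable divides at least one of them) and is a Cremona set, i.e. $k[F]\subset R^{(2)}$ is a birational extension (the fields of fractions of $k[F]$ and of the second Veronese subring $R^{(2)}$ of $R$ coincide); equivalently, $F$ defines a birational map $\mathbb P^{n-1}\dashrightarrow\mathbb P^{n-1}$. Let $G=G_F$ be the graph with vertices $x_1,\dots,x_n$ and edges the members of $F$, where $x_ax_b$ joins $x_a$ to $x_b$ and a pure square $x_a^2$ is a loop at $x_a$. Then $G$ has a unique circuit, a loop being regarded as a circuit of length $1$. Let $r$ be its length. For $j\ge 1$ let $s_j$ be the number of edges in the $j$th neighborhood of the circuit, i.e. of edges that join a vertex at distance $j-1$ from the circuit to a vertex at distance $j$ from it, and let $s$ be the number of vertices off the circuit whose degree in $G$ is at least $2$. There is a unique monomial inverse $F^{-1}=\{\mathbf x^{w_1},\dots,\mathbf x^{w_n}\}$ of $F$ satisfying the canonical restrictions: $n$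 distinct monomials of one and the same degree, with no nontrivial common factor and such that every variable divides at least one of them, for which the rational maps of $\mathbb P^{n-1}$ defined by $(\mathbf x^{v_1}:\dots:\mathbf x^{v_n})$ and $(\mathbf x^{w_1}:\dots:\mathbf x^{w_n})$ are inverse to each other. The following conditions are equivalent: (a) The ideal $(F^{-1})\subset R$ is of linear type, i.e. the natural surjection from its symmetric algebra to its Rees algebra is injective. (b) The ideal $(F)\subset R$ is linearly presented, i.e. the module of syzygies of the monomials of $F$ is generated by syzygies whose coordinates are linear forms. (c) The edge graph of $G$ has diameter $\le 2$. (The edge graph is the simple graph whose vertices are the edges of $G$, loops included, two distinct ones being adjacent if and only if they share an end.) (d) One of the following holds: $r=1$, $s_j=0$ for all $j\ge 3$, and $s\le 1$; or $r=3$ and $s_j=0$ for all $j\ge 2$; or $r=5$ and $s_j=0$ for all $j\ge 1$. -/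

import Mathlib

noncomputable section

namespace MonomialCremona

/-! ### Graphs with loops: edge graph, circuits, neighborhoods -/

section Graphs

variable {α β : Type*}

/-- The edge graph of `G`: its vertices are the edges of `G` (loops included), and two distinct
edges are adjacent when they share an end. -/
def edgeGraph (G : Graph α β) : SimpleGraph G.edgeSet where
  Adj e f := e ≠ f ∧ ∃ x, G.Inc e x ∧ G.Inc f x
  symm := ⟨fun _ _ h => ⟨h.1.symm, h.2.imp fun _ hx => ⟨hx.2, hx.1⟩⟩⟩
  loopless := ⟨fun _ h => h.1 rfl⟩

/-- `C` is the edge set of a circuit of length `r ≥ 1` of `G`: there are distinct vertices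
`x 0, …, x (r-1)` and distinct edges `e 0, …, e (r-1)`, where `e i` joins `x i` to its cyclic
successor, and `C` consists of these edges. A circuit of length `1` is a loop. -/
def IsCircuit (G : Graph α β) (r : ℕ) (C : Set β) : Prop :=
  1 ≤ r ∧ ∃ (x : Fin r → α) (e : Fin r → β), Function.Injective x ∧ Function.Injective e ∧
    (∀ i, G.IsLink (e i) (x i) (x (finRotate r i))) ∧ C = Set.range e

/-- The vertices of `G` that lie on some edge in `C`. -/
def vertexSupport (G : Graph α β) (C : Set β) : Set α := {x | ∃ e ∈ C, G.Inc e x}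

/-- The simple graph obtained from `G` by forgetting loops and multiplicities of edges; it is
used only to measure distances. -/
def underlyingGraph (G : Graph α β) : SimpleGraph α where
  Adj x y := x ≠ y ∧ G.Adj x y
  symm := ⟨fun _ _ h => ⟨h.1.symm, h.2.symm⟩⟩
  loopless := ⟨fun _ h => h.1 rfl⟩

/-- The distance in `G` of a vertex `x` from the circuit with edge set `C`. -/
def distToCircuit (G : Graph α β) (C : Set β) (x : α) : ℕ∞ :=
  ⨅ y ∈ vertexSupport G C, (underlyingGraph G).edist y x

/-- The number `s_j` (for `j ≥ 1`) of edges in the `j`-th neighborhood of the circuit `C`: those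
that join a vertex at distance `j - 1` from `C` to a vertex at distance `j` from `C`. -/
def neighborhoodSize (G : Graph α β) (C : Set β) (j : ℕ) : ℕ :=
  {e | ∃ x y, G.IsLink e x y ∧ distToCircuit G C x + 1 = j ∧ distToCircuit G C y = j}.ncard

/-- The degree of a vertex; a loop counts twice. -/
def vertexDegree (G : Graph α β) (x : α) : ℕ :=
  (G.incidenceSet x).ncard + (G.loopSet x).ncard

/-- The number `s` of vertices off the circuit `C` whose degree is at least `2`. -/
def offCircuitBranching (G : Graph α β) (C : Set β) : ℕ :=
  {x | x ∈ G.vertexSet ∧ x ∉ vertexSupport G C ∧ 2 ≤ vertexDegree G x}.ncard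

end Graphs

/-! ### Ideals of linear type and linearly presented ideals -/

/-- The natural `R`-algebra homomorphism from the symmetric algebra of the ideal `I` to its Rees
algebra `R[IT] ⊆ R[T]`, which sends `a ∈ I` in degree one to `a T`. -/
def symToRees {R : Type*} [CommRing R] (I : Ideal R) : SymmetricAlgebra R I →ₐ[R] reesAlgebra I :=
  SymmetricAlgebra.lift
    (LinearMap.codRestrict (Subalgebra.toSubmodule (reesAlgebra I))
      ((Polynomial.monomial 1 : R →ₗ[R] Polynomial R).comp (Submodule.subtype I))
      (fun a => reesAlgebra.monomial_mem.mpr (by simp)))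

/-- `I` is of linear type: the natural surjection from the symmetric algebra of `I` to the Rees
algebra of `I` is injective. -/
def IsLinearType {R : Type*} [CommRing R] (I : Ideal R) : Prop :=
  Function.Injective (symToRees I)

/-- Linear presentation of the ideal generated by the forms `f i`, where these are forms of one
and the same degree that generate the ideal minimally: the module of syzygies of the `f i` is
generated by the linear syzygies, i.e. those whose coordinates are forms of degree one. -/
def IsLinearlyPresented {σ ι k : Type*} [Fintype ι] [Field k] (f : ι → MvPolynomial σ k) : Prop :=
  LinearMap.ker (Fintype.linearCombination (MvPolynomial σ k) f) =
    Submodule.span (MvPolynomial σ k)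
      {a | a ∈ LinearMap.ker (Fintype.linearCombination (MvPolynomial σ k) f) ∧
        ∀ i, (a i).IsHomogeneous 1}

/-! ### Monomial Cremona maps -/

section Monomials

variable (k : Type*) [Field k] {n : ℕ}

/-- The monomials with exponent vectors `v 0, …, v (n-1)`. -/
def monomials (v : Fin n → Fin n →₀ ℕ) (j : Fin n) : MvPolynomial (Fin n) k :=
  MvPolynomial.monomial (v j) 1

/-- `v` lists `n` distinct vectors of `ℕⁿ` that form a `d`-stochastic set (the corresponding
monomials all have degree `d`) and satisfy the canonical restrictions: the monomials have no
nontrivial common factor, and every variable divides at least one of them. -/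
structure IsStochasticSet (v : Fin n → Fin n →₀ ℕ) (d : ℕ) : Prop where
  injective : Function.Injective v
  degree_eq : ∀ j, (v j).degree = d
  exists_eq_zero : ∀ i, ∃ j, v j i = 0
  exists_ne_zero : ∀ i, ∃ j, v j i ≠ 0

/-- The field of fractions, inside `k(x)`, of the `k`-algebra generated by a set of polynomials. -/
def fractionSubfield (S : Set (MvPolynomial (Fin n) k)) :
    IntermediateField k (FractionRing (MvPolynomial (Fin n) k)) :=
  IntermediateField.adjoin k
    (algebraMap (MvPolynomial (Fin n) k) (FractionRing (MvPolynomial (Fin n) k)) '' S)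

/-- The monomials with exponents `v` form a Cremona set in degree `d`: the `n` monomials `F` have
degree `d`, satisfy the canonical restrictions, and the extension `k[F] ⊆ R^(d)` of the
`d`-th Veronese subring `R^(d)` of `R = k[x]`, which is generated by all monomials of degree `d`,
is birational (equality of fields of fractions). -/
structure IsCremonaSet (v : Fin n → Fin n →₀ ℕ) (d : ℕ) : Prop extends IsStochasticSet v d where
  birational : fractionSubfield k (Set.range (monomials k v)) =
    fractionSubfield k {m | ∃ α : Fin n →₀ ℕ, α.degree = d ∧ m = MvPolynomial.monomial α 1}

/-- The composite `x ↦ g (f x)` of two rational maps of projective space, given by tuples of forms, is the identity: its coordinates are proportional to the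
variables by a nonzero factor. -/
def CompIsIdentity (f g : Fin n → MvPolynomial (Fin n) k) : Prop :=
  ∃ h : MvPolynomial (Fin n) k, h ≠ 0 ∧
    ∀ j, MvPolynomial.aeval f (g j) = h * MvPolynomial.X j

/-- The monomials with exponents `w` form a set that satisfies the canonical restrictions, with
all members of one degree, and define the rational map inverse to the one defined by the monomials
with exponents `v`. -/
structure IsCremonaInverse (v w : Fin n → Fin n →₀ ℕ) : Prop where
  stochastic : ∃ δ, IsStochasticSet w δ
  left_inverse : CompIsIdentity k (monomials k v) (monomials k w)
  right_inverse : CompIsIdentity k (monomials k w) (monomials k v)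

end Monomials

/-- The graph of a set of monomials of degree `2`: the vertices are the variables, the `e`-th
monomial `x_a x_b` is an edge with ends `a` and `b`, and pure squares are loops. -/
def graphOf {n : ℕ} (v : Fin n → Fin n →₀ ℕ) : Graph (Fin n) (Fin n) where
  vertexSet := Set.univ
  IsLink e a b := v e = Finsupp.single a 1 + Finsupp.single b 1
  isLink_symm _ _ := ⟨fun _ _ h => h.trans (add_comm _ _)⟩
  eq_or_eq_of_isLink_of_isLink := by
    intro e x y a b h h'
    have hx := DFunLike.congr_fun (h.symm.trans h') x
    by_contra hne
    push Not at hne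
    simp [Finsupp.single_apply, Ne.symm hne.1, Ne.symm hne.2] at hx
  left_mem_of_isLink := fun _ _ _ _ => Set.mem_univ _

end MonomialCremona

end

open MonomialCremona

noncomputable section

namespace MonomialCremona

open Finsupp (single)

/-! ### The lattice spanned by the exponents -/

section Lattice

variable {n : ℕ}

/-! Each of (a)–(d) is shown to be equivalent to one combinatorial property, `IsGapFree`: any two
edges of $G$ share an end or are joined by a third edge. For (c) this is a reading of paths of
length at most two in the edge graph.

For (b), syzygies of monomials are generated by the binomial ones, given by $x^\mu x^{v_e}=x^\nu
x^{v_f}$. If there are no gaps, each of these is a composition of linear ones: two edges with a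
common end need one linear move, disjoint edges need two, through the joining edge
(`IsGapFree.rel_of_add_eq`). If $e,f$ form a gap, no other member of $F$ divides $x^{v_e+v_f}$
(`eq_or_eq_of_le_add`), so linear syzygies cannot produce the Koszul syzygy of $e$ and $f$.

For (a), the Rees algebras of $F$ and of $F^{-1}$ have the same binomial equations with the
variables $x$ and $y$ interchanged, as both describe the graph of the birational map (`fiber_swap`).
Quadratic monomials with independent exponents always generate an ideal of linear type
(`con_of_fiber_eq`), so the equations for $F^{-1}$ are generated by those linear in $x$. Linearity
in $y$ then becomes the question settled in (b): the $x$-linear equations split into bilinear ones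
if there are no gaps, and a gap gives the equation $y^{v_f}x_e-y^{v_e}x_f$, which is not a
consequence of $y$-linear ones.

For (d), birationality puts all vectors of degree 2 in the lattice of the exponents, so the
determinant is nonzero. A nonzero term of its expansion assigns to each vertex $i$ an edge of its
own, and $G$ becomes the graph of a self-map $f$ with edges $\{i,f(i)\}$ (`exists_matching`).
Periodic orbits of $f$ give circuits, and alternating sums along circuits show that a circuit is odd
and unique. Distance to the circuit counts steps of $f$ until a periodic point, and what remains is
a case check on the period (`isGapFreeMap_iff`). -/

/-- The integer matrix whose rows are the exponent vectors. -/
def exponentMatrix (v : Fin n → Fin n →₀ ℕ) : Matrix (Fin n) (Fin n) ℤ :=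
  Matrix.of fun j i => (v j i : ℤ)

/-- A vector of natural numbers, regarded as an integer vector. -/
def intVec (α : Fin n →₀ ℕ) : Fin n → ℤ := fun i => (α i : ℤ)

@[simp] lemma intVec_apply (α : Fin n →₀ ℕ) (i : Fin n) : intVec α i = (α i : ℤ) := rfl

lemma intVec_add (α β : Fin n →₀ ℕ) : intVec (α + β) = intVec α + intVec β := by
  ext i; simp

lemma intVec_injective : Function.Injective (intVec (n := n)) := by
  intro α β h
  ext i
  have := congrFun h i
  simpa using this

lemma linearCombination_apply_apply (v : Fin n → Fin n →₀ ℕ) (β : Fin n →₀ ℕ) (i : Fin n) :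
    Finsupp.linearCombination ℕ v β i = ∑ j, β j * v j i := by
  rw [Finsupp.linearCombination_apply, Finsupp.sum_fintype _ _ (by simp), Finsupp.finsetSum_apply]
  simp

lemma intVec_linearCombination (v : Fin n → Fin n →₀ ℕ) (β : Fin n →₀ ℕ) :
    intVec (Finsupp.linearCombination ℕ v β) = Matrix.vecMul (intVec β) (exponentMatrix v) := by
  ext i
  simp [linearCombination_apply_apply, Matrix.vecMul, dotProduct, exponentMatrix]

lemma intVec_row (v : Fin n → Fin n →₀ ℕ) (j : Fin n) :
    Matrix.vecMul (Pi.single j 1) (exponentMatrix v) = intVec (v j) := by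
  ext i; simp [exponentMatrix]

lemma degree_linearCombination {v : Fin n → Fin n →₀ ℕ} {d : ℕ} (hv : ∀ j, (v j).degree = d)
    (β : Fin n →₀ ℕ) : (Finsupp.linearCombination ℕ v β).degree = d * β.degree := by
  induction β using Finsupp.induction_linear with
  | zero => simp
  | add f g hf hg => simp [hf, hg, mul_add]
  | single a b => simp [hv, mul_comm]

variable (k : Type*) [Field k]

lemma aeval_monomials_monomial (v : Fin n → Fin n →₀ ℕ) (β : Fin n →₀ ℕ) (c : k) :
    MvPolynomial.aeval (monomials k v) (MvPolynomial.monomial β c) =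
      MvPolynomial.monomial (Finsupp.linearCombination ℕ v β) c := by
  rw [MvPolynomial.aeval_monomial, Finsupp.linearCombination_apply, MvPolynomial.algebraMap_eq]
  simp only [monomials, MvPolynomial.monomial_pow, one_pow]
  rw [MvPolynomial.monomial_finsupp_sum_index]

lemma exists_of_mem_support_aeval_monomials (v : Fin n → Fin n →₀ ℕ)
    (p : MvPolynomial (Fin n) k) {γ : Fin n →₀ ℕ}
    (h : γ ∈ (MvPolynomial.aeval (monomials k v) p).support) :
    ∃ β, γ = Finsupp.linearCombination ℕ v β := by
  classical
  rw [p.as_sum, map_sum] at h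
  obtain ⟨β, -, hβ⟩ := Finset.mem_biUnion.mp (MvPolynomial.support_sum h)
  rw [aeval_monomials_monomial] at hβ
  exact ⟨β, by simpa using MvPolynomial.support_monomial_subset hβ⟩

/-- Birationality puts every vector of the given degree in the lattice spanned by the exponents. -/
lemma IsCremonaSet.exists_vecMul_eq {k : Type*} [Field k] {v : Fin n → Fin n →₀ ℕ} {d : ℕ}
    (hv : IsCremonaSet k v d) {α : Fin n →₀ ℕ} (hα : α.degree = d) :
    ∃ z, Matrix.vecMul z (exponentMatrix v) = intVec α := by
  classical
  let A := algebraMap (MvPolynomial (Fin n) k) (FractionRing (MvPolynomial (Fin n) k))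
  have hA : Function.Injective A := IsFractionRing.injective _ _
  have hmem : A (MvPolynomial.monomial α 1) ∈ fractionSubfield k (Set.range (monomials k v)) := by
    rw [hv.birational]
    exact IntermediateField.subset_adjoin _ _ ⟨_, ⟨α, hα, rfl⟩, rfl⟩
  rw [fractionSubfield, ← Set.range_comp, IntermediateField.mem_adjoin_range_iff] at hmem
  obtain ⟨r, s, hrs⟩ := hmem
  have key : ∀ p : MvPolynomial (Fin n) k,
      MvPolynomial.aeval (algebraMap (MvPolynomial (Fin n) k)
        (FractionRing (MvPolynomial (Fin n) k)) ∘ monomials k v) p =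
      A (MvPolynomial.aeval (monomials k v) p) := by
    intro p
    exact MvPolynomial.aeval_algebraMap_apply _ _ p
  rw [key, key] at hrs
  have hs : MvPolynomial.aeval (monomials k v) s ≠ 0 := by
    intro h
    rw [h, map_zero, div_zero] at hrs
    have := hA (hrs.trans (map_zero A).symm)
    simp at this
  have hs' : A (MvPolynomial.aeval (monomials k v) s) ≠ 0 := fun h =>
    hs (hA (h.trans (map_zero A).symm))
  rw [eq_div_iff hs', ← map_mul] at hrs
  have hrs := hA hrs
  -- Now $r(F)=x^\alpha s(F)$. An exponent of $s(F)$, shifted by $\alpha$, is an exponent of $r(F)$,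
  -- and exponents of both are combinations of the rows; $\alpha$ is the difference of two of them.
  obtain ⟨γ, hγ⟩ := MvPolynomial.ne_zero_iff.mp hs
  have hγ' : γ ∈ (MvPolynomial.aeval (monomials k v) s).support := by simpa using hγ
  obtain ⟨β, rfl⟩ := exists_of_mem_support_aeval_monomials k v s hγ'
  obtain ⟨β', hβ'⟩ := exists_of_mem_support_aeval_monomials k v r
    (γ := α + Finsupp.linearCombination ℕ v β) (by
      rw [← hrs, MvPolynomial.mem_support_iff, MvPolynomial.coeff_monomial_mul]
      simpa using hγ)
  refine ⟨intVec β' - intVec β, ?_⟩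
  rw [Matrix.sub_vecMul, ← intVec_linearCombination, ← intVec_linearCombination, ← hβ',
    intVec_add]
  simp

lemma intVec_single (i : Fin n) (m : ℕ) : intVec (single i m) = Pi.single i (m : ℤ) := by
  ext j
  simp [Finsupp.single_apply, Pi.single_apply, eq_comm]

/-- All $2e_i$ lie in the row lattice, so the exponent matrix divides $2\cdot 1$ on the right. -/
lemma IsCremonaSet.det_ne_zero {k : Type*} [Field k] {v : Fin n → Fin n →₀ ℕ}
    (hv : IsCremonaSet k v 2) : (exponentMatrix v).det ≠ 0 := by
  choose z hz using fun i : Fin n => hv.exists_vecMul_eq (α := single i 2) (by simp)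
  have : Matrix.of z * exponentMatrix v = (2 : ℤ) • (1 : Matrix (Fin n) (Fin n) ℤ) := by
    ext i j
    have := congrFun (hz i) j
    rw [intVec_single] at this
    rw [Matrix.mul_apply_eq_vecMul]
    refine this.trans ?_
    simp [Matrix.one_apply, Pi.single_apply, eq_comm]
  intro h
  have := congrArg Matrix.det this
  rw [Matrix.det_mul, h, Matrix.det_smul] at this
  simp at this
  exact absurd this (by positivity)

lemma IsCremonaSet.vecMul_injective {k : Type*} [Field k] {v : Fin n → Fin n →₀ ℕ}
    (hv : IsCremonaSet k v 2) {y z : Fin n → ℤ}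
    (h : Matrix.vecMul y (exponentMatrix v) = Matrix.vecMul z (exponentMatrix v)) : y = z := by
  rw [← sub_eq_zero, ← Matrix.sub_vecMul] at h
  exact sub_eq_zero.mp (Matrix.eq_zero_of_vecMul_eq_zero hv.det_ne_zero h)

lemma IsCremonaSet.linearCombination_injective {k : Type*} [Field k] {v : Fin n → Fin n →₀ ℕ}
    (hv : IsCremonaSet k v 2) : Function.Injective (Finsupp.linearCombination ℕ v) := by
  intro α β h
  apply intVec_injective
  apply hv.vecMul_injective
  rw [← intVec_linearCombination, ← intVec_linearCombination, h]

lemma IsCremonaSet.exists_vecMul_eq_single_sub {k : Type*} [Field k] {v : Fin n → Fin n →₀ ℕ}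
    (hv : IsCremonaSet k v 2) (a b : Fin n) :
    ∃ z, Matrix.vecMul z (exponentMatrix v) = Pi.single a 1 - Pi.single b 1 := by
  obtain ⟨y, hy⟩ := hv.exists_vecMul_eq (α := single a 1 + single b 1) (by simp)
  obtain ⟨z, hz⟩ := hv.exists_vecMul_eq (α := single b 1 + single b 1) (by simp)
  refine ⟨y - z, ?_⟩
  rw [Matrix.sub_vecMul, hy, hz]
  simp [intVec_add, intVec_single]

lemma exists_eq_single_one {β : Fin n →₀ ℕ} (h : β.degree = 1) : ∃ b, β = single b 1 :=
  (Finsupp.sum_eq_one_iff β).mp (by rw [← h, Finsupp.degree_apply]; rfl)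

lemma exists_eq_single_add_single {α : Fin n →₀ ℕ} (hα : α.degree = 2) {a : Fin n}
    (ha : α a ≠ 0) : ∃ b, α = single a 1 + single b 1 := by
  have h1 : single a 1 ≤ α := by
    rw [Finsupp.single_le_iff]; omega
  obtain ⟨β, rfl⟩ := exists_add_of_le h1
  have h2 : β.degree = 1 := by
    rw [map_add, Finsupp.degree_single] at hα; omega
  obtain ⟨b, rfl⟩ := exists_eq_single_one h2
  exact ⟨b, rfl⟩

end Lattice

/-! ### Moves between monomials in a fiber -/

section Fibers

variable {n : ℕ}

/-- Any two of the monomials have a common variable, or are joined by a third one. -/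
def IsGapFree (v : Fin n → Fin n →₀ ℕ) : Prop :=
  ∀ e f, (∃ u, v e u ≠ 0 ∧ v f u ≠ 0) ∨
    ∃ g a b, v e a ≠ 0 ∧ v f b ≠ 0 ∧ v g = single a 1 + single b 1

/-- In the gap-free case, linear moves connect all pairs `(μ, e)` with the same `μ + v e`. -/
lemma IsGapFree.rel_of_add_eq {v : Fin n → Fin n →₀ ℕ} (hv : IsGapFree v)
    (hd : ∀ j, (v j).degree = 2) (hinj : Function.Injective v)
    (r : Setoid ((Fin n →₀ ℕ) × Fin n))
    (hadd : ∀ κ μ ν e f, r (μ, e) (ν, f) → r (κ + μ, e) (κ + ν, f))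
    (hlin : ∀ a b e f, single a 1 + v e = single b 1 + v f → r (single a 1, e) (single b 1, f))
    {μ ν : Fin n →₀ ℕ} {e f : Fin n} (h : μ + v e = ν + v f) : r (μ, e) (ν, f) := by
  by_cases hef : e = f
  · subst hef
    rw [add_right_cancel h]
  by_cases hs : ∃ u, v e u ≠ 0 ∧ v f u ≠ 0
  · obtain ⟨u, hue, huf⟩ := hs
    obtain ⟨p, hp⟩ := exists_eq_single_add_single (hd e) hue
    obtain ⟨q, hq⟩ := exists_eq_single_add_single (hd f) huf
    have hpq : p ≠ q := by
      rintro rfl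
      exact hef (hinj (hp.trans hq.symm))
    have h' : μ + single p 1 = ν + single q 1 := by
      rw [hp, hq] at h
      apply add_right_cancel (b := single u 1)
      rw [add_assoc, add_assoc, add_comm (single p 1), add_comm (single q 1), h]
    have hle : single q 1 ≤ μ := by
      rw [Finsupp.single_le_iff]
      have := DFunLike.congr_fun h' q
      simp [hpq] at this
      omega
    obtain ⟨κ, rfl⟩ := exists_add_of_le hle
    have hν : ν = κ + single p 1 := by
      apply add_right_cancel (b := single q 1)
      rw [← h']; abel
    subst hν
    rw [add_comm (single q 1)]
    apply hadd
    apply hlin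
    rw [hp, hq]; abel
  · have hz : ∀ u, v e u = 0 ∨ v f u = 0 := by
      intro u
      by_contra! hu
      exact hs ⟨u, hu⟩
    obtain ⟨g, a, b, ha, hb, hg⟩ := (hv e f).resolve_left hs
    obtain ⟨a', ha'⟩ := exists_eq_single_add_single (hd e) ha
    obtain ⟨b', hb'⟩ := exists_eq_single_add_single (hd f) hb
    have hle : v f ≤ μ := by
      intro u
      have := DFunLike.congr_fun h u
      simp only [Finsupp.add_apply] at this
      rcases hz u with h0 | h0 <;> omega
    obtain ⟨κ, rfl⟩ := exists_add_of_le hle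
    have hν : ν = κ + v e := by
      apply add_right_cancel (b := v f)
      rw [← h]; abel
    subst hν
    rw [add_comm (v f)]
    apply hadd
    have h1 : r (v f, e) (single b' 1 + single a' 1, g) := by
      rw [hb', add_comm (single b 1)]
      apply hadd
      apply hlin
      rw [ha', hg]; abel
    have h2 : r (single b' 1 + single a' 1, g) (v e, f) := by
      rw [ha', add_comm (single b' 1), add_comm (single a 1)]
      apply hadd
      apply hlin
      rw [hb', hg]; abel
    exact r.trans h1 h2

/-- If `x^α y^β` and `x^α' y^β'` lie in one fiber and the edge `e` of `β` has an end that divides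
`x^α'`, then a `y`-linear move brings the edge `e` into the second monomial. -/
lemma exists_move {v : Fin n → Fin n →₀ ℕ} (hd : ∀ j, (v j).degree = 2)
    {α β α' β' : Fin n →₀ ℕ} (hdeg : β.degree = β'.degree)
    (h : α + Finsupp.linearCombination ℕ v β = α' + Finsupp.linearCombination ℕ v β')
    {e u : Fin n} (he : β e ≠ 0) (hu : v e u ≠ 0) (hα' : α' u ≠ 0) :
    ∃ μ ν κ β₁ f, μ + v f = ν + v e ∧ α' = κ + μ ∧ β' = β₁ + single f 1 := by
  classical
  obtain ⟨w, hw⟩ := exists_eq_single_add_single (hd e) hu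
  have hle : single u 1 ≤ α' := by rw [Finsupp.single_le_iff]; omega
  -- If $x^{v_e}$ divides $x^{\alpha'}$, it can be traded for any edge of `β'`. Otherwise the other
  -- end `w` of `e` (possibly `w = u`) is short in $x^{\alpha'}$, so the fiber equation forces an
  -- edge `f` of `β'` through `w`, and the move trades `u` for the other end of `f`.
  by_cases hle2 : v e ≤ α'
  · have : β' ≠ 0 := by
      rintro rfl
      rw [map_zero, Finsupp.degree_eq_zero_iff] at hdeg
      simp [hdeg] at he
    obtain ⟨f, hf⟩ := Finsupp.ne_iff.mp this
    simp only [Finsupp.coe_zero, Pi.zero_apply] at hf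
    obtain ⟨κ, hκ⟩ := exists_add_of_le hle2
    obtain ⟨β₁, hβ₁⟩ := exists_add_of_le (show single f 1 ≤ β' by
      rw [Finsupp.single_le_iff]; omega)
    exact ⟨v e, v f, κ, β₁, f, add_comm _ _, by rw [hκ, add_comm], by rw [hβ₁, add_comm]⟩
  · have hwα : α' w < v e w := by
      by_contra! hcon
      apply hle2
      intro i
      by_cases hiw : i = w
      · rw [hiw]; exact hcon
      · have := hle i
        rw [hw]
        simpa [Finsupp.single_apply, Ne.symm hiw] using this
    have hlt : v e w ≤ Finsupp.linearCombination ℕ v β w := by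
      rw [linearCombination_apply_apply]
      refine le_trans ?_ (Finset.single_le_sum (f := fun j => β j * v j w) (fun _ _ => Nat.zero_le _)
        (Finset.mem_univ e))
      exact Nat.le_mul_of_pos_left _ (Nat.pos_of_ne_zero he)
    have hne : Finsupp.linearCombination ℕ v β' w ≠ 0 := by
      have := DFunLike.congr_fun h w
      simp only [Finsupp.add_apply] at this
      omega
    rw [linearCombination_apply_apply] at hne
    obtain ⟨f, -, hf⟩ := Finset.exists_ne_zero_of_sum_ne_zero hne
    have hf1 := left_ne_zero_of_mul hf
    obtain ⟨z, hz⟩ := exists_eq_single_add_single (hd f) (right_ne_zero_of_mul hf)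
    obtain ⟨κ, hκ⟩ := exists_add_of_le hle
    obtain ⟨β₁, hβ₁⟩ := exists_add_of_le (show single f 1 ≤ β' by
      rw [Finsupp.single_le_iff]; omega)
    refine ⟨single u 1, single z 1, κ, β₁, f, ?_, by rw [hκ, add_comm], by rw [hβ₁, add_comm]⟩
    rw [hz, hw]; abel

/-- The ideal generated by linearly independent monomials of degree two is of linear type:
`y`-linear moves connect the fibers. -/
lemma con_of_fiber_eq {v : Fin n → Fin n →₀ ℕ} (hd : ∀ j, (v j).degree = 2)
    (hind : Function.Injective (Finsupp.linearCombination ℕ v))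
    (c : AddCon ((Fin n →₀ ℕ) × (Fin n →₀ ℕ)))
    (hc : ∀ μ ν e f, μ + v e = ν + v f → c (μ, single e 1) (ν, single f 1))
    (α β α' β' : Fin n →₀ ℕ) (hdeg : β.degree = β'.degree)
    (h : α + Finsupp.linearCombination ℕ v β = α' + Finsupp.linearCombination ℕ v β') :
    c (α, β) (α', β') := by
  classical
  induction hN : α.degree + β.degree using Nat.strong_induction_on generalizing α β α' β' with
  | _ N ih =>
  have hdegα : α.degree = α'.degree := by
    have := congrArg Finsupp.degree h
    rw [map_add, map_add, degree_linearCombination hd, degree_linearCombination hd, hdeg] at this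
    omega
  -- a common edge can be cancelled
  have common : ∀ α β α' β' : Fin n →₀ ℕ, β.degree = β'.degree →
      α + Finsupp.linearCombination ℕ v β = α' + Finsupp.linearCombination ℕ v β' →
      α.degree + β.degree = N → ∀ e, β e ≠ 0 → β' e ≠ 0 → c (α, β) (α', β') := by
    intro α β α' β' hdeg h hN e he he'
    obtain ⟨γ, rfl⟩ := exists_add_of_le (show single e 1 ≤ β by
      rw [Finsupp.single_le_iff]; omega)
    obtain ⟨γ', rfl⟩ := exists_add_of_le (show single e 1 ≤ β' by
      rw [Finsupp.single_le_iff]; omega)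
    rw [map_add, map_add, Finsupp.degree_single] at hdeg
    have hih := ih (α.degree + γ.degree) (by
      rw [← hN, map_add, Finsupp.degree_single]; omega) α γ α' γ' (by omega) (by
      rw [map_add, map_add] at h
      apply add_left_cancel (a := Finsupp.linearCombination ℕ v (single e 1))
      rw [add_left_comm, h, add_left_comm]) rfl
    have := c.add (c.refl (0, single e 1)) hih
    simpa using this
  -- an edge with an end in the other monomial
  have step : ∀ α β α' β' : Fin n →₀ ℕ, β.degree = β'.degree →
      α + Finsupp.linearCombination ℕ v β = α' + Finsupp.linearCombination ℕ v β' →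
      α.degree + β.degree = N → ∀ e u, β e ≠ 0 → v e u ≠ 0 → α' u ≠ 0 →
      c (α, β) (α', β') := by
    intro α β α' β' hdeg h hN e u he hu hα'
    obtain ⟨μ, ν, κ, β₁, f, hμ, rfl, rfl⟩ := exists_move hd hdeg h he hu hα'
    have h1 : c (κ + ν, β₁ + single e 1) (κ + μ, β₁ + single f 1) := by
      have := c.add (c.refl (κ, β₁)) (hc _ _ _ _ hμ.symm)
      simpa using this
    refine c.trans (common α β (κ + ν) (β₁ + single e 1) ?_ ?_ hN e he (by simp)) h1
    · rw [hdeg]; simp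
    · rw [h]
      simp only [map_add, Finsupp.linearCombination_single, one_smul]
      rw [add_add_add_comm, add_add_add_comm κ ν, hμ]
  -- a common vertex can be cancelled
  by_cases hx : ∃ i, α i ≠ 0 ∧ α' i ≠ 0
  · obtain ⟨i, hi, hi'⟩ := hx
    obtain ⟨γ, rfl⟩ := exists_add_of_le (show single i 1 ≤ α by
      rw [Finsupp.single_le_iff]; omega)
    obtain ⟨γ', rfl⟩ := exists_add_of_le (show single i 1 ≤ α' by
      rw [Finsupp.single_le_iff]; omega)
    have hih := ih (γ.degree + β.degree) (by
      rw [← hN, map_add, Finsupp.degree_single]; omega) γ β γ' β' hdeg (by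
      apply add_left_cancel (a := single i 1)
      rw [← add_assoc, h, add_assoc]) rfl
    have := c.add (c.refl (single i 1, 0)) hih
    simpa using this
  by_cases hs : ∃ e u, β e ≠ 0 ∧ v e u ≠ 0 ∧ α' u ≠ 0
  · obtain ⟨e, u, he, hu, hα'⟩ := hs
    exact step α β α' β' hdeg h hN e u he hu hα'
  by_cases hs' : ∃ e u, β' e ≠ 0 ∧ v e u ≠ 0 ∧ α u ≠ 0
  · obtain ⟨e, u, he, hu, hα⟩ := hs'
    exact c.symm (step α' β' α β hdeg.symm h.symm (by omega) e u he hu hα)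
  have touch : ∀ β : Fin n →₀ ℕ, ∀ u, Finsupp.linearCombination ℕ v β u ≠ 0 →
      ∃ e, β e ≠ 0 ∧ v e u ≠ 0 := by
    intro β u hu
    rw [linearCombination_apply_apply] at hu
    obtain ⟨e, -, he⟩ := Finset.exists_ne_zero_of_sum_ne_zero hu
    exact ⟨e, left_ne_zero_of_mul he, right_ne_zero_of_mul he⟩
  -- No variable is shared, and no edge of either side touches the $x$-part of the other side. So a
  -- variable in only one of the two $x$-parts would have exponent zero on the opposite side of the
  -- equation.
  have hαα : α = α' := by
    ext u
    have hu := DFunLike.congr_fun h u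
    simp only [Finsupp.add_apply] at hu
    by_contra hne
    have h1 : ¬ (α u ≠ 0 ∧ α' u ≠ 0) := fun hh => hx ⟨u, hh⟩
    have h2 : Finsupp.linearCombination ℕ v β u ≠ 0 → α' u = 0 := by
      intro hh
      obtain ⟨e, he, heu⟩ := touch β u hh
      by_contra hcon
      exact hs ⟨e, u, he, heu, hcon⟩
    have h3 : Finsupp.linearCombination ℕ v β' u ≠ 0 → α u = 0 := by
      intro hh
      obtain ⟨e, he, heu⟩ := touch β' u hh
      by_contra hcon
      exact hs' ⟨e, u, he, heu, hcon⟩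
    omega
  subst hαα
  rw [hind (add_left_cancel h)]
  exact c.refl _

end Fibers

/-! ### The monomial inverse -/

section Inverse

variable {n : ℕ}

/-- Exponent form of `CompIsIdentity` for monomials. -/
def IsLeftInverse (v w : Fin n → Fin n →₀ ℕ) : Prop :=
  ∃ η : Fin n →₀ ℕ, ∀ j, Finsupp.linearCombination ℕ v (w j) = η + single j 1

lemma compIsIdentity_monomials_iff (k : Type*) [Field k] (v w : Fin n → Fin n →₀ ℕ) :
    CompIsIdentity k (monomials k v) (monomials k w) ↔ IsLeftInverse v w := by
  classical
  constructor
  · rintro ⟨h, h0, hj⟩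
    obtain ⟨η, hη⟩ := MvPolynomial.ne_zero_iff.mp h0
    refine ⟨η, fun j => ?_⟩
    have := hj j
    rw [monomials, aeval_monomials_monomial] at this
    have h1 := congrArg (MvPolynomial.coeff (η + single j 1)) this
    rw [MvPolynomial.coeff_mul_X, MvPolynomial.coeff_monomial] at h1
    by_contra hne
    rw [if_neg hne] at h1
    exact hη h1.symm
  · rintro ⟨η, hη⟩
    refine ⟨MvPolynomial.monomial η 1, by simp, fun j => ?_⟩
    rw [monomials, aeval_monomials_monomial, hη, MvPolynomial.X, MvPolynomial.monomial_mul, one_mul]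

lemma IsLeftInverse.linearCombination {v w : Fin n → Fin n →₀ ℕ} {η : Fin n →₀ ℕ}
    (h : ∀ j, Finsupp.linearCombination ℕ v (w j) = η + single j 1) (β : Fin n →₀ ℕ) :
    Finsupp.linearCombination ℕ v (Finsupp.linearCombination ℕ w β) = β.degree • η + β := by
  induction β using Finsupp.induction_linear with
  | zero => simp
  | add f g hf hg => simp only [map_add, hf, hg, add_smul]; abel
  | single a b => simp [h, smul_add]

/-- Fibers of the Rees algebra of `w` are fibers of the Rees algebra of `v`, with the two groups
of variables interchanged. -/
lemma fiber_swap {v w : Fin n → Fin n →₀ ℕ} (h : IsLeftInverse v w) {α β α' β' : Fin n →₀ ℕ}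
    (hdeg : β.degree = β'.degree)
    (hf : α + Finsupp.linearCombination ℕ w β = α' + Finsupp.linearCombination ℕ w β') :
    β + Finsupp.linearCombination ℕ v α = β' + Finsupp.linearCombination ℕ v α' := by
  obtain ⟨η, hη⟩ := h
  have := congrArg (Finsupp.linearCombination ℕ v) hf
  rw [map_add, map_add, IsLeftInverse.linearCombination hη, IsLeftInverse.linearCombination hη,
    hdeg] at this
  apply add_left_cancel (a := β'.degree • η)
  rw [← add_assoc, ← add_assoc, add_comm, this, add_comm]

lemma exists_finsupp_of_nonneg {z : Fin n → ℤ} (hz : ∀ i, 0 ≤ z i) :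
    ∃ α : Fin n →₀ ℕ, intVec α = z := by
  refine ⟨Finsupp.equivFunOnFinite.symm fun i => (z i).toNat, ?_⟩
  ext i
  simp [hz i]

lemma intVec_degree (α : Fin n →₀ ℕ) : (α.degree : ℤ) = ∑ i, intVec α i := by
  simp [Finsupp.degree_eq_sum]

lemma sum_vecMul_exponentMatrix {v : Fin n → Fin n →₀ ℕ} {d : ℕ} (hd : ∀ j, (v j).degree = d)
    (z : Fin n → ℤ) : ∑ i, Matrix.vecMul z (exponentMatrix v) i = d * ∑ j, z j := by
  simp only [Matrix.vecMul, dotProduct]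
  rw [Finset.sum_comm, Finset.mul_sum]
  refine Finset.sum_congr rfl fun j _ => ?_
  rw [← Finset.mul_sum, mul_comm]
  congr 1
  rw [← hd j, intVec_degree]
  rfl

/-- Solve $z_jV=e_j-e_o$ over the integers and subtract from every coordinate its minimum over $j$.
The entries become nonnegative, each coordinate vanishes for some $j$ (no common factor), and $z_jV$
changes by a vector that does not depend on $j$. -/
lemma IsCremonaSet.exists_isLeftInverse {k : Type*} [Field k] (hn : 2 ≤ n)
    {v : Fin n → Fin n →₀ ℕ} (hv : IsCremonaSet k v 2) :
    ∃ w, (∃ δ, IsStochasticSet w δ) ∧ IsLeftInverse v w := by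
  classical
  let o : Fin n := ⟨0, by omega⟩
  have : Nonempty (Fin n) := ⟨o⟩
  have : Nontrivial (Fin n) := Fin.nontrivial_iff_two_le.mpr hn
  choose z hz using fun j => hv.exists_vecMul_eq_single_sub j o
  choose m hm using fun i => Finite.exists_min fun j => z j i
  choose w hw using fun j => exists_finsupp_of_nonneg (z := fun i => z j i - z (m i) i)
    (fun i => sub_nonneg.mpr (hm i j))
  have hw' : ∀ j i, (w j i : ℤ) = z j i - z (m i) i := fun j i => congrFun (hw j) i
  have hzsum : ∀ j, ∑ i, z j i = 0 := by
    intro j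
    have := sum_vecMul_exponentMatrix hv.degree_eq (z j)
    rw [hz] at this
    simpa using this
  refine ⟨w, ⟨(w o).degree, ?_, ?_, ?_, ?_⟩, ?_⟩
  · intro j j' hjj
    have hzz : z j = z j' := by
      ext i
      have h1 := hw' j i
      have h2 := hw' j' i
      rw [hjj] at h1
      omega
    have h3 := hz j
    rw [hzz, hz j', sub_left_inj] at h3
    by_contra hne
    have := congrFun h3 j
    simp [hne] at this
  · intro j
    have : ∀ j, ((w j).degree : ℤ) = - ∑ i, z (m i) i := by
      intro j
      rw [intVec_degree, hw j, Finset.sum_sub_distrib, hzsum, zero_sub]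
    exact_mod_cast (this j).trans (this o).symm
  · intro i
    refine ⟨m i, ?_⟩
    have := hw' (m i) i
    omega
  · intro i
    -- If coordinate `i` of every `w j` vanished, coordinate `i` of every `z j` would equal that of
    -- `z o = 0`. But $e_i-e_j$ is a combination of the `z l`.
    by_contra! hcon
    have hzi : ∀ j, z j i = 0 := by
      intro j
      have hzo : z o = 0 := hv.vecMul_injective (by rw [hz]; simp)
      have h1 := hw' j i
      have h2 := hw' o i
      have h3 := congrFun hzo i
      rw [hcon] at h1 h2
      simp only [Pi.zero_apply] at h3
      omega
    obtain ⟨j, hj⟩ := exists_ne i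
    -- the difference of two rows is a combination of the `z l`
    have key : Matrix.vecMul (∑ l, ((v i l : ℤ) - v j l) • z l) (exponentMatrix v) =
        Matrix.vecMul (Pi.single i 1 - Pi.single j 1) (exponentMatrix v) := by
      rw [Matrix.sub_vecMul, intVec_row, intVec_row, Matrix.sum_vecMul]
      simp only [Matrix.smul_vecMul, hz, smul_sub, Finset.sum_sub_distrib]
      rw [← Finset.sum_smul, Finset.sum_sub_distrib]
      have hdi := intVec_degree (v i)
      have hdj := intVec_degree (v j)
      rw [hv.degree_eq] at hdi hdj
      simp only [intVec_apply] at hdi hdj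
      rw [← hdi, ← hdj, sub_self, zero_smul, sub_zero]
      ext l
      simp [Finset.sum_apply, Pi.single_apply]
    have := congrFun (hv.vecMul_injective key) i
    simp [hzi, Ne.symm hj] at this
  · have hwV : ∀ j, intVec (Finsupp.linearCombination ℕ v (w j)) =
        Pi.single j 1 + (- Pi.single o 1 - Matrix.vecMul (fun i => z (m i) i) (exponentMatrix v)) := by
      intro j
      rw [intVec_linearCombination, hw j]
      change Matrix.vecMul (z j - fun i => z (m i) i) (exponentMatrix v) = _
      rw [Matrix.sub_vecMul, hz]
      abel
    obtain ⟨η, hη⟩ := exists_finsupp_of_nonneg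
      (z := - Pi.single o 1 - Matrix.vecMul (fun i => z (m i) i) (exponentMatrix v)) (by
        intro l
        -- Coordinate `l` of the candidate for `η` is read off from a row `j ≠ l`, where $e_j$
        -- contributes nothing; this is where $n\ge 2$ enters.
        obtain ⟨j, hj⟩ := exists_ne l
        have := congrFun (hwV j) l
        simp only [intVec_apply, Pi.add_apply, Pi.single_apply, hj.symm, if_false, zero_add] at this
        rw [← this]
        positivity)
    refine ⟨η, fun j => intVec_injective ?_⟩
    rw [hwV, intVec_add, hη, intVec_single, add_comm]
    simp

/-- From $w_jV=\eta+e_j$ it follows that $(v_jW-e_j)V=2\eta$, whatever $j$ is. As $V$ is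
nonsingular, $v_jW-e_j$ is independent of $j$. -/
lemma IsCremonaSet.isLeftInverse_symm {k : Type*} [Field k] (hn : 2 ≤ n)
    {v w : Fin n → Fin n →₀ ℕ} (hv : IsCremonaSet k v 2) (h : IsLeftInverse v w) :
    IsLeftInverse w v := by
  classical
  let o : Fin n := ⟨0, by omega⟩
  have : Nontrivial (Fin n) := Fin.nontrivial_iff_two_le.mpr hn
  obtain ⟨η, hη⟩ := h
  -- `D j` is the row `j` of `VW - 1`; all these rows agree
  let D : Fin n → Fin n → ℤ := fun j =>
    intVec (Finsupp.linearCombination ℕ w (v j)) - Pi.single j 1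
  have hD : ∀ j j', D j = D j' := by
    have : ∀ j, Matrix.vecMul (D j) (exponentMatrix v) = (2 : ℕ) • intVec η := by
      intro j
      rw [Matrix.sub_vecMul, intVec_row, ← intVec_linearCombination,
        IsLeftInverse.linearCombination hη, hv.degree_eq, intVec_add]
      ext i
      simp
    intro j j'
    exact hv.vecMul_injective ((this j).trans (this j').symm)
  obtain ⟨θ, hθ⟩ := exists_finsupp_of_nonneg (z := D o) (by
    intro l
    obtain ⟨j, hj⟩ := exists_ne l
    rw [hD o j]
    simp [D, hj.symm])
  refine ⟨θ, fun j => intVec_injective ?_⟩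
  rw [intVec_add, hθ, hD o j, intVec_single]
  simp [D]

/-- The differences $w_j-w'_j$ all have the image $\eta-\eta'$ under $V$, so they agree. In each
coordinate both families have minimum zero, so the common difference is zero. -/
lemma IsCremonaSet.isLeftInverse_unique {k : Type*} [Field k]
    {v w w' : Fin n → Fin n →₀ ℕ} (hv : IsCremonaSet k v 2)
    (h : IsLeftInverse v w) (h' : IsLeftInverse v w') (h0 : ∀ i, ∃ j, w j i = 0)
    (h0' : ∀ i, ∃ j, w' j i = 0) : w' = w := by
  obtain ⟨η, hη⟩ := h
  obtain ⟨η', hη'⟩ := h'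
  have key : ∀ j l, intVec (w j) - intVec (w' j) = intVec (w l) - intVec (w' l) := by
    have : ∀ j, Matrix.vecMul (intVec (w j) - intVec (w' j)) (exponentMatrix v) =
        intVec η - intVec η' := by
      intro j
      rw [Matrix.sub_vecMul, ← intVec_linearCombination, ← intVec_linearCombination, hη, hη',
        intVec_add, intVec_add]
      abel
    intro j l
    exact hv.vecMul_injective ((this j).trans (this l).symm)
  ext j i
  obtain ⟨a, ha⟩ := h0 i
  obtain ⟨b, hb⟩ := h0' i
  have h1 := congrFun (key j a) i
  have h2 := congrFun (key j b) i
  simp only [Pi.sub_apply, intVec_apply, ha, hb] at h1 h2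
  omega

end Inverse

/-! ### Syzygies of monomials -/

section Syzygies

open MvPolynomial (monomial coeff)

variable {n : ℕ} {k : Type*} [Field k]

lemma mem_ker_linearCombination_monomials {u : Fin n → Fin n →₀ ℕ}
    {a : Fin n → MvPolynomial (Fin n) k} :
    a ∈ LinearMap.ker (Fintype.linearCombination (MvPolynomial (Fin n) k) (monomials k u)) ↔
      ∑ b, a b * monomial (u b) 1 = 0 := by
  rw [LinearMap.mem_ker, Fintype.linearCombination_apply]
  rfl

/-- A coefficient of a syzygy vanishes if no other monomial divides the one it contributes to. -/
lemma coeff_eq_zero_of_isolated {u : Fin n → Fin n →₀ ℕ} {a : Fin n → MvPolynomial (Fin n) k}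
    (h : ∑ b, a b * monomial (u b) 1 = 0) {c : Fin n} {ε : Fin n →₀ ℕ}
    (hiso : ∀ b, u b ≤ u c + ε → b = c) : coeff ε (a c) = 0 := by
  classical
  have h1 := congrArg (coeff (u c + ε)) h
  rw [MvPolynomial.coeff_sum, Finset.sum_eq_single c] at h1
  · rw [MvPolynomial.coeff_mul_monomial', if_pos le_self_add] at h1
    simpa using h1
  · intro b _ hb
    rw [MvPolynomial.coeff_mul_monomial', if_neg fun hle => hb (hiso b hle)]
  · simp

lemma single_mul_sub_single_mem_ker {u : Fin n → Fin n →₀ ℕ} {μ ν : Fin n →₀ ℕ} {e f : Fin n}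
    (h : μ + u e = ν + u f) :
    Pi.single e (monomial μ 1) - Pi.single f (monomial ν 1) ∈
      LinearMap.ker (Fintype.linearCombination (MvPolynomial (Fin n) k) (monomials k u)) := by
  classical
  rw [mem_ker_linearCombination_monomials]
  simp [sub_mul, Finset.sum_sub_distrib, Pi.single_apply, MvPolynomial.monomial_mul, h]

/-- If two monomials `x^μ`, `x^ν` with `μ + u e = ν + u f` always give congruent elements
`x^μ e`, `x^ν f`, then every syzygy is congruent to zero. -/
lemma linearMap_eq_zero_of_mem_ker {N : Type*} [AddCommGroup N] [Module k N]
    {u : Fin n → Fin n →₀ ℕ} (q : (Fin n → MvPolynomial (Fin n) k) →ₗ[k] N)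
    (hq : ∀ μ ν e f, μ + u e = ν + u f →
      q (Pi.single e (monomial μ 1)) = q (Pi.single f (monomial ν 1)))
    {a : Fin n → MvPolynomial (Fin n) k} (ha : ∑ b, a b * monomial (u b) 1 = 0) : q a = 0 := by
  classical
  let t : (Fin n →₀ ℕ) × Fin n → N := fun p => q (Pi.single p.2 (monomial p.1 1))
  -- The value of `q` on $x^\mu e$ depends only on the product $x^{\mu+u_e}$. So `q` factors through
  -- the map sending a tuple to its combination of the monomials, which kills syzygies.
  have ht : Function.FactorsThrough t (fun p => p.1 + u p.2) := fun p p' h => hq _ _ _ _ h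
  obtain ⟨t', ht'⟩ := (Function.factorsThrough_iff _).mp ht
  let T := (MvPolynomial.basisMonomials (Fin n) k).constr k t'
  have key : ∀ e (p : MvPolynomial (Fin n) k),
      q (Pi.single e p) = T (p * monomial (u e) 1) := by
    intro e p
    induction p using MvPolynomial.induction_on' with
    | monomial μ c =>
      have h1 : T (monomial (μ + u e) 1) = t' (μ + u e) := by
        have := (MvPolynomial.basisMonomials (Fin n) k).constr_basis k t' (μ + u e)
        rwa [MvPolynomial.coe_basisMonomials] at this
      have h2 : q (Pi.single e (monomial μ 1)) = t' (μ + u e) := congrFun ht' (μ, e)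
      have h3 : (monomial μ c : MvPolynomial (Fin n) k) = c • monomial μ 1 := by
        rw [MvPolynomial.smul_monomial, smul_eq_mul, mul_one]
      have h4 : (Pi.single e (c • monomial μ 1) : Fin n → MvPolynomial (Fin n) k) =
          c • Pi.single e (monomial μ 1) := Pi.single_smul e c _
      rw [h3, h4, map_smul, h2, smul_mul_assoc, map_smul, MvPolynomial.monomial_mul,
        one_mul, h1]
    | add p q hp hq => rw [Pi.single_add, map_add, hp, hq, add_mul, map_add]
  have : a = ∑ e, Pi.single e (a e) := (Finset.univ_sum_single a).symm
  rw [this, map_sum]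
  simp_rw [key]
  rw [← map_sum, ha, map_zero]

lemma IsGapFree.isLinearlyPresented {v : Fin n → Fin n →₀ ℕ} (hv : IsGapFree v)
    (hd : ∀ j, (v j).degree = 2) (hinj : Function.Injective v) :
    IsLinearlyPresented (monomials k v) := by
  classical
  apply le_antisymm
  · intro a ha
    rw [mem_ker_linearCombination_monomials] at ha
    set L := Submodule.span (MvPolynomial (Fin n) k)
      {a | a ∈ LinearMap.ker (Fintype.linearCombination (MvPolynomial (Fin n) k)
        (monomials k v)) ∧ ∀ i, (a i).IsHomogeneous 1} with hL
    let t : (Fin n →₀ ℕ) × Fin n → ((Fin n → MvPolynomial (Fin n) k) ⧸ L) :=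
      fun p => L.mkQ (Pi.single p.2 (monomial p.1 1))
    have key : ∀ {μ ν e f}, μ + v e = ν + v f → Setoid.ker t (μ, e) (ν, f) :=
      hv.rel_of_add_eq hd hinj (Setoid.ker t) (by
      intro κ μ ν e f h
      rw [Setoid.ker_def] at h ⊢
      have hm : ∀ μ e, t (κ + μ, e) = (monomial κ 1 : MvPolynomial (Fin n) k) • t (μ, e) := by
        intro μ e
        simp only [t]
        rw [← map_smul, ← Pi.single_smul, smul_eq_mul, MvPolynomial.monomial_mul, one_mul]
      rw [hm, hm, h]) (by
      intro a b e f h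
      rw [Setoid.ker_def]
      simp only [t]
      rw [← sub_eq_zero, ← map_sub, Submodule.mkQ_apply, Submodule.Quotient.mk_eq_zero]
      refine Submodule.subset_span ⟨single_mul_sub_single_mem_ker h, fun i => ?_⟩
      have hX : ∀ (a e : Fin n), (Pi.single (M := fun _ => MvPolynomial (Fin n) k) e
          (monomial (single a 1) 1) i).IsHomogeneous 1 := by
        intro a e
        rw [Pi.single_apply]
        split_ifs
        · exact MvPolynomial.isHomogeneous_X k a
        · exact MvPolynomial.isHomogeneous_zero _ _ _
      exact (hX a e).sub (hX b f))
    have := linearMap_eq_zero_of_mem_ker (k := k) (u := v) (L.mkQ.restrictScalars k)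
      (fun μ ν e f h => Setoid.ker_def.mp (key h)) ha
    simpa using this
  · rw [Submodule.span_le]
    exact fun a ha => ha.1

/-- The vertices of two edges without a common end or a joining edge span no other edge. -/
lemma eq_or_eq_of_le_add {v : Fin n → Fin n →₀ ℕ} (hd : ∀ j, (v j).degree = 2)
    (hinj : Function.Injective v) {e f : Fin n}
    (hs : ∀ u, v e u = 0 ∨ v f u = 0)
    (hg : ∀ g a b, v e a ≠ 0 → v f b ≠ 0 → v g ≠ single a 1 + single b 1) {g : Fin n}
    (hle : v g ≤ v e + v f) : g = e ∨ g = f := by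
  classical
  have eq_of_le : ∀ g e, v g ≤ v e → g = e := by
    intro g e hle
    obtain ⟨δ, hδ⟩ := exists_add_of_le hle
    have : δ = 0 := by
      have := congrArg Finsupp.degree hδ
      rw [map_add, hd, hd] at this
      rw [← Finsupp.degree_eq_zero_iff]
      omega
    rw [this, add_zero] at hδ
    exact (hinj hδ).symm
  -- An edge `g` that meets `e` cannot have its other end on `f`, since it would join the two; hence
  -- `v g ≤ v e`.
  have main : ∀ e f : Fin n, (∀ u, v e u = 0 ∨ v f u = 0) →
      (∀ g a b, v e a ≠ 0 → v f b ≠ 0 → v g ≠ single a 1 + single b 1) →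
      v g ≤ v e + v f → ∀ a, v g a ≠ 0 → v e a ≠ 0 → g = e := by
    intro e f hs hg hle a hga hea
    apply eq_of_le
    obtain ⟨b, hb⟩ := exists_eq_single_add_single (hd g) hga
    have hfb : v f b = 0 := by
      by_contra hne
      exact hg g a b hea hne hb
    have hfa : v f a = 0 := (hs a).resolve_left hea
    intro i
    have h1 := hle i
    simp only [Finsupp.add_apply] at h1
    by_cases hia : i = a
    · subst hia; omega
    by_cases hib : i = b
    · subst hib; omega
    · rw [hb]; simp [Ne.symm hia, Ne.symm hib]
  obtain ⟨a, ha⟩ : ∃ a, v g a ≠ 0 := by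
    by_contra! hcon
    have : v g = 0 := by ext i; simp [hcon]
    have h2 := hd g
    rw [this] at h2
    simp at h2
  have h1 := hle a
  simp only [Finsupp.add_apply] at h1
  by_cases hea : v e a = 0
  · right
    refine main f e (fun u => (hs u).symm) (fun g a b ha hb h => hg g b a hb ha ?_)
      (by rwa [add_comm]) a ha (by omega)
    rw [h, add_comm]
  · exact Or.inl (main e f hs hg hle a ha hea)

lemma not_isGapFree_iff {v : Fin n → Fin n →₀ ℕ} : ¬ IsGapFree v ↔
    ∃ e f, (∀ u, v e u = 0 ∨ v f u = 0) ∧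
      ∀ g a b, v e a ≠ 0 → v f b ≠ 0 → v g ≠ single a 1 + single b 1 := by
  simp only [IsGapFree, not_forall, not_or, not_exists, not_and, not_not, ← or_iff_not_imp_left]

lemma not_le_single {α : Fin n →₀ ℕ} (hα : α.degree = 2) (z : Fin n) : ¬ α ≤ single z 1 := by
  intro h
  have := Finsupp.degree_mono h
  rw [hα, Finsupp.degree_single] at this
  omega

lemma isGapFree_of_isLinearlyPresented {v : Fin n → Fin n →₀ ℕ}
    (hd : ∀ j, (v j).degree = 2) (hinj : Function.Injective v)
    (h : IsLinearlyPresented (monomials k v)) : IsGapFree v := by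
  classical
  by_contra hcon
  obtain ⟨e, f, hs, hg⟩ := not_isGapFree_iff.mp hcon
  have hef : e ≠ f := by
    rintro rfl
    have : v e = 0 := by ext u; simpa using hs u
    have h2 := hd e
    rw [this] at h2
    simp at h2
  have hmem := single_mul_sub_single_mem_ker (k := k) (u := v) (add_comm (v f) (v e))
  rw [h] at hmem
  -- The arbitrary factor `q` makes the vanishing stable under scalar multiplication, so that the
  -- induction over the span goes through.
  have key : ∀ a ∈ Submodule.span (MvPolynomial (Fin n) k)
      {a | a ∈ LinearMap.ker (Fintype.linearCombination (MvPolynomial (Fin n) k)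
        (monomials k v)) ∧ ∀ i, (a i).IsHomogeneous 1},
      ∀ q : MvPolynomial (Fin n) k, coeff (v f) (q * a e) = 0 := by
    intro a ha
    induction ha using Submodule.span_induction with
    | mem a ha =>
      intro q
      rw [MvPolynomial.coeff_mul]
      refine Finset.sum_eq_zero fun x hx => ?_
      rw [Finset.HasAntidiagonal.mem_antidiagonal] at hx
      by_cases h1 : x.2.degree = 1
      · obtain ⟨z, hz⟩ := exists_eq_single_one h1
        rw [coeff_eq_zero_of_isolated (mem_ker_linearCombination_monomials.mp ha.1), mul_zero]
        intro b hb
        have hx2 : x.2 ≤ v f := by rw [← hx]; exact le_add_self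
        refine (eq_or_eq_of_le_add hd hinj hs hg (hb.trans (by gcongr))).resolve_right ?_
        rintro rfl
        apply not_le_single (hd b) z
        intro i
        have := hb i
        rw [hz] at this
        simp only [Finsupp.add_apply] at this
        rcases hs i with h0 | h0 <;> omega
      · rw [(ha.2 e).coeff_eq_zero h1, mul_zero]
    | zero => simp
    | add a b _ _ ha hb => intro q; rw [Pi.add_apply, mul_add, MvPolynomial.coeff_add, ha, hb, add_zero]
    | smul r a _ ha => intro q; rw [Pi.smul_apply, smul_eq_mul, ← mul_assoc]; exact ha _
  have := key _ hmem 1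
  simp [hef] at this

end Syzygies

/-! ### Linear type in terms of equations of the Rees algebra -/

section Rees

variable {R ι : Type*} [CommRing R] [Fintype ι]

/-- The ideal generated by the linear forms `∑ a j * y j` for the syzygies `a` of `f`. -/
def linearRelations (f : ι → R) : Ideal (MvPolynomial ι R) :=
  Ideal.span (Fintype.linearCombination R (MvPolynomial.X : ι → MvPolynomial ι R) ''
    LinearMap.ker (Fintype.linearCombination R f))

/-- The presentation of the Rees algebra of the ideal generated by `f`. -/
def reesPresentation (f : ι → R) : MvPolynomial ι R →ₐ[R] Polynomial R :=
  MvPolynomial.aeval fun j => Polynomial.monomial 1 (f j)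

lemma exists_linearMap_comp_eq {M I N : Type*} [AddCommGroup M] [AddCommGroup I] [AddCommGroup N]
    [Module R M] [Module R I] [Module R N] (l : M →ₗ[R] I) (hl : Function.Surjective l)
    (g : M →ₗ[R] N) (h : LinearMap.ker l ≤ LinearMap.ker g) :
    ∃ t : I →ₗ[R] N, ∀ a, t (l a) = g a := by
  refine ⟨(LinearMap.ker l).liftQ g h ∘ₗ (l.quotKerEquivOfSurjective hl).symm.toLinearMap,
    fun a => ?_⟩
  have : (l.quotKerEquivOfSurjective hl).symm (l a) = Submodule.Quotient.mk a := by
    rw [LinearEquiv.symm_apply_eq]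
    rfl
  simp [this]

/-- Both algebras are quotients of $R[y]$, and the symmetric algebra is the quotient by the linear
relations; so injectivity says that these relations exhaust the Rees equations. -/
theorem isLinearType_iff_ker_le (f : ι → R) :
    IsLinearType (Ideal.span (Set.range f)) ↔
      RingHom.ker (reesPresentation f) ≤ linearRelations f := by
  classical
  set I := Ideal.span (Set.range f) with hI
  let gens : ι → I := fun j => ⟨f j, Ideal.subset_span ⟨j, rfl⟩⟩
  let l : (ι → R) →ₗ[R] I := Fintype.linearCombination R gens
  have hl : ∀ a, (l a : R) = Fintype.linearCombination R f a := by
    intro a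
    simp [l, Fintype.linearCombination_apply, gens]
  have hlker : LinearMap.ker l = LinearMap.ker (Fintype.linearCombination R f) := by
    ext a
    rw [LinearMap.mem_ker, LinearMap.mem_ker, ← hl, ZeroMemClass.coe_eq_zero]
  have hlsurj : Function.Surjective l := by
    rintro ⟨x, hx⟩
    rw [hI, Ideal.span, ← Fintype.range_linearCombination] at hx
    obtain ⟨a, ha⟩ := hx
    exact ⟨a, Subtype.ext ((hl a).trans ha)⟩
  let π : MvPolynomial ι R →ₐ[R] SymmetricAlgebra R I :=
    MvPolynomial.aeval fun j => SymmetricAlgebra.ι R I (gens j)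
  have hπlin : ∀ a, π (Fintype.linearCombination R MvPolynomial.X a) =
      SymmetricAlgebra.ι R I (l a) := by
    intro a
    simp [π, l, Fintype.linearCombination_apply]
  have hπsurj : Function.Surjective π := by
    intro s
    induction s using SymmetricAlgebra.induction with
    | algebraMap r => exact ⟨algebraMap _ _ r, π.commutes r⟩
    | ι x =>
      obtain ⟨a, rfl⟩ := hlsurj x
      exact ⟨_, hπlin a⟩
    | mul a b ha hb =>
      obtain ⟨p, rfl⟩ := ha
      obtain ⟨q, rfl⟩ := hb
      exact ⟨p * q, map_mul _ _ _⟩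
    | add a b ha hb =>
      obtain ⟨p, rfl⟩ := ha
      obtain ⟨q, rfl⟩ := hb
      exact ⟨p + q, map_add _ _ _⟩
  have hcomp : ∀ p, (symToRees I (π p) : Polynomial R) = reesPresentation f p := by
    have : ((reesAlgebra I).val.comp (symToRees I)).comp π = reesPresentation f := by
      apply MvPolynomial.algHom_ext
      intro j
      simp [π, symToRees, reesPresentation, gens]
      rfl
    exact fun p => DFunLike.congr_fun this p
  constructor
  · intro hinj p hp
    -- The linear map $I\to R[y]/(\text{linear relations})$, $f_j\mapsto y_j$, extends to the
    -- symmetric algebra and recovers the class of a polynomial from its image there.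
    obtain ⟨t, ht⟩ := exists_linearMap_comp_eq l hlsurj
      ((Ideal.Quotient.mkₐ R (linearRelations f)).toLinearMap ∘ₗ
        Fintype.linearCombination R (MvPolynomial.X : ι → MvPolynomial ι R)) (by
      intro a ha
      rw [LinearMap.mem_ker, LinearMap.comp_apply, AlgHom.toLinearMap_apply,
        Ideal.Quotient.mkₐ_eq_mk, Ideal.Quotient.eq_zero_iff_mem]
      exact Ideal.subset_span ⟨a, hlker ▸ ha, rfl⟩)
    have hψ : (SymmetricAlgebra.lift t).comp π = Ideal.Quotient.mkₐ R (linearRelations f) := by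
      apply MvPolynomial.algHom_ext
      intro j
      have hj := ht (Pi.single j 1)
      simp only [l, Fintype.linearCombination_apply_single, one_smul, LinearMap.comp_apply] at hj
      simpa [π] using hj
    have h0 : π p = 0 := by
      apply hinj
      apply Subtype.ext
      rw [hcomp, map_zero]
      exact hp
    have := DFunLike.congr_fun hψ p
    rw [AlgHom.comp_apply, h0, map_zero, Ideal.Quotient.mkₐ_eq_mk] at this
    exact Ideal.Quotient.eq_zero_iff_mem.mp this.symm
  · intro hker
    have hle : linearRelations f ≤ RingHom.ker π := by
      rw [linearRelations, Ideal.span_le]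
      rintro _ ⟨a, ha, rfl⟩
      rw [SetLike.mem_coe, RingHom.mem_ker, hπlin]
      rw [SetLike.mem_coe, ← hlker, LinearMap.mem_ker] at ha
      rw [ha, map_zero]
    refine (injective_iff_map_eq_zero (symToRees I)).mpr fun s hs => ?_
    obtain ⟨p, rfl⟩ := hπsurj s
    have : p ∈ RingHom.ker (reesPresentation f) := by
      rw [RingHom.mem_ker, ← hcomp, hs]
      rfl
    exact hle (hker this)

end Rees

section MonomialRees

open MvPolynomial (monomial coeff)

variable {n : ℕ} {k : Type*} [Field k]

lemma reesPresentation_monomial (w : Fin n → Fin n →₀ ℕ) (α β : Fin n →₀ ℕ) (c : k) :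
    reesPresentation (monomials k w) (monomial β (monomial α c)) =
      Polynomial.monomial β.degree (monomial (α + Finsupp.linearCombination ℕ w β) c) := by
  have h1 : ∀ β : Fin n →₀ ℕ, reesPresentation (monomials k w) (monomial β 1) =
      Polynomial.monomial β.degree (monomial (Finsupp.linearCombination ℕ w β) 1) := by
    intro β
    induction β using Finsupp.induction_linear with
    | zero => simp [← MvPolynomial.C_apply]
    | add f g hf hg =>
      have : (monomial (f + g) 1 : MvPolynomial (Fin n) (MvPolynomial (Fin n) k)) =
          monomial f 1 * monomial g 1 := by rw [MvPolynomial.monomial_mul, one_mul]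
      rw [this, map_mul, hf, hg, Polynomial.monomial_mul_monomial, MvPolynomial.monomial_mul,
        map_add, map_add, one_mul]
    | single a b =>
      rw [reesPresentation, MvPolynomial.aeval_monomial]
      simp [monomials, Polynomial.monomial_pow, MvPolynomial.monomial_pow]
  have h2 : (monomial β (monomial α c) : MvPolynomial (Fin n) (MvPolynomial (Fin n) k)) =
      (monomial α c : MvPolynomial (Fin n) k) • monomial β 1 := by
    rw [MvPolynomial.smul_monomial, smul_eq_mul, mul_one]
  rw [h2, map_smul, h1, Polynomial.smul_monomial, smul_eq_mul, MvPolynomial.monomial_mul, mul_one]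

/-- A `k`-linear map that is constant on the monomials of each fiber of the Rees algebra kills all
equations of the Rees algebra. -/
lemma linearMap_eq_zero_of_mem_ker_reesPresentation {N : Type*} [AddCommGroup N] [Module k N]
    {w : Fin n → Fin n →₀ ℕ} (q : MvPolynomial (Fin n) (MvPolynomial (Fin n) k) →ₗ[k] N)
    (hq : ∀ α β α' β' : Fin n →₀ ℕ, β.degree = β'.degree →
      α + Finsupp.linearCombination ℕ w β = α' + Finsupp.linearCombination ℕ w β' →
      q (monomial β (monomial α 1)) = q (monomial β' (monomial α' 1)))
    {p : MvPolynomial (Fin n) (MvPolynomial (Fin n) k)}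
    (hp : reesPresentation (monomials k w) p = 0) : q p = 0 := by
  let t : (Fin n →₀ ℕ) × (Fin n →₀ ℕ) → N := fun p => q (monomial p.2 (monomial p.1 1))
  have ht : Function.FactorsThrough t
      (fun p => (p.1 + Finsupp.linearCombination ℕ w p.2, p.2.degree)) := by
    rintro ⟨α, β⟩ ⟨α', β'⟩ h
    exact hq _ _ _ _ (congrArg Prod.snd h) (congrArg Prod.fst h)
  obtain ⟨t', ht'⟩ := (Function.factorsThrough_iff _).mp ht
  let T : Polynomial (MvPolynomial (Fin n) k) →ₗ[k] N := Polynomial.lsum fun d =>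
    (MvPolynomial.basisMonomials (Fin n) k).constr k fun γ => t' (γ, d)
  have hT : ∀ d γ (c : k), T (Polynomial.monomial d (monomial γ c)) = c • t' (γ, d) := by
    intro d γ c
    have := (MvPolynomial.basisMonomials (Fin n) k).constr_basis k (fun γ => t' (γ, d)) γ
    rw [MvPolynomial.coe_basisMonomials] at this
    have h3 : (monomial γ c : MvPolynomial (Fin n) k) = c • monomial γ 1 := by
      rw [MvPolynomial.smul_monomial, smul_eq_mul, mul_one]
    simp only [T, Polynomial.lsum_apply]
    refine (Polynomial.sum_monomial_index _ _ (LinearMap.map_zero _)).trans ?_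
    rw [h3, map_smul, this]
  have key : ∀ p, q p = T (reesPresentation (monomials k w) p) := by
    intro p
    induction p using MvPolynomial.induction_on' with
    | add p p' h h' => rw [map_add, h, h', map_add, map_add]
    | monomial β a =>
      induction a using MvPolynomial.induction_on' with
      | add p p' h h' => simp only [map_add, h, h']
      | monomial α c =>
        have h3 : (monomial β (monomial α c) : MvPolynomial (Fin n) (MvPolynomial (Fin n) k)) =
            c • monomial β (monomial α 1) := by
          rw [MvPolynomial.smul_monomial, MvPolynomial.smul_monomial, smul_eq_mul, mul_one]
        rw [reesPresentation_monomial, hT, h3, map_smul]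
        congr 1
        exact congrFun ht' (α, β)
  rw [key, hp, map_zero]

/-- Congruence modulo the linear relations of $w$ is an additive congruence on pairs of exponents.
It contains the bilinear moves, hence by gap-freeness all moves of `con_of_fiber_eq`, and so
identifies the monomials of each fiber. The group of variables listed first is $y$, in accordance
with the swap. -/
lemma IsGapFree.isLinearType {v w : Fin n → Fin n →₀ ℕ} (hv : IsGapFree v)
    (hd : ∀ j, (v j).degree = 2) (hinj : Function.Injective v)
    (hind : Function.Injective (Finsupp.linearCombination ℕ v)) {δ : ℕ}
    (hwd : ∀ j, (w j).degree = δ) (hvw : IsLeftInverse v w) (hwv : IsLeftInverse w v) :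
    IsLinearType (Ideal.span (Set.range (monomials k w))) := by
  classical
  rw [isLinearType_iff_ker_le]
  intro p hp
  set L := linearRelations (monomials k w) with hL
  let g : (Fin n →₀ ℕ) × (Fin n →₀ ℕ) → MvPolynomial (Fin n) (MvPolynomial (Fin n) k) ⧸ L :=
    fun x => Ideal.Quotient.mk L (monomial x.1 (monomial x.2 1))
  have hg : ∀ x y, g (x + y) = g x * g y := by
    intro x y
    simp only [g]
    rw [← map_mul, MvPolynomial.monomial_mul, MvPolynomial.monomial_mul, one_mul]
    rfl
  let c : AddCon ((Fin n →₀ ℕ) × (Fin n →₀ ℕ)) :=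
    { Setoid.ker g with
      add' := by
        intro x y x' y' h h'
        change g _ = g _ at h h'
        change g _ = g _
        rw [hg, hg, h, h'] }
  have hc : ∀ {x y}, c x y ↔ g x = g y := Iff.rfl
  have hmove : ∀ μ ν e f, μ + v e = ν + v f → c (μ, single e 1) (ν, single f 1) := by
    intro μ ν e f h
    have := hv.rel_of_add_eq hd hinj (Setoid.ker fun x : (Fin n →₀ ℕ) × Fin n =>
      g (x.1, single x.2 1)) (by
        intro κ μ ν e f h
        rw [Setoid.ker_def] at h ⊢
        have := c.add (c.refl (κ, 0)) (hc.mpr h)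
        simpa [hc] using this) (by
        intro a b e f h
        rw [Setoid.ker_def]
        have hw : single e 1 + w a = single f 1 + w b := by
          simpa using fiber_swap hwv (α := single a 1) (β := single e 1) (α' := single b 1)
            (β' := single f 1) (by simp) (by simpa using h)
        have hmem := single_mul_sub_single_mem_ker (k := k) hw
        refine Ideal.Quotient.eq.mpr (Ideal.subset_span ⟨_, hmem, ?_⟩)
        rw [map_sub, Fintype.linearCombination_apply_single, Fintype.linearCombination_apply_single,
          MvPolynomial.X, MvPolynomial.X, MvPolynomial.smul_monomial, MvPolynomial.smul_monomial,
          smul_eq_mul, mul_one, smul_eq_mul, mul_one]) h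
    exact hc.mpr this
  have := linearMap_eq_zero_of_mem_ker_reesPresentation (w := w)
    ((Ideal.Quotient.mkₐ k L).toLinearMap) (by
      intro α β α' β' hdeg h
      have h' := fiber_swap hvw hdeg h
      have hα : α.degree = α'.degree := by
        have := congrArg Finsupp.degree h
        rw [map_add, map_add, degree_linearCombination hwd, degree_linearCombination hwd, hdeg]
          at this
        omega
      exact hc.mp (con_of_fiber_eq hd hind c hmove β α β' α' hα h')) hp
  exact Ideal.Quotient.eq_zero_iff_mem.mp this

/-- For a gap $e,f$ the monomial $y^{v_f}x_e$ occurs in a Rees equation but in no multiple of a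
linear relation: for $j$ an end of $f$, the only $w_b$ dividing $x_e x^{w_j}$ is $w_j$ itself, by
`fiber_swap` and `eq_or_eq_of_le_add`. -/
lemma isGapFree_of_isLinearType {v w : Fin n → Fin n →₀ ℕ}
    (hd : ∀ j, (v j).degree = 2) (hinj : Function.Injective v) {δ : ℕ}
    (hwd : ∀ j, (w j).degree = δ) (hvw : IsLeftInverse v w) (hwv : IsLeftInverse w v)
    (h : IsLinearType (Ideal.span (Set.range (monomials k w)))) : IsGapFree v := by
  classical
  rw [isLinearType_iff_ker_le] at h
  by_contra hcon
  obtain ⟨e, f, hs, hg⟩ := not_isGapFree_iff.mp hcon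
  have hef : v e ≠ v f := by
    intro heq
    have : v e = 0 := by ext u; simpa [← heq] using hs u
    have h2 := hd e
    rw [this] at h2
    simp at h2
  have hP : (monomial (v f) (monomial (single e 1) 1) - monomial (v e) (monomial (single f 1) 1) :
      MvPolynomial (Fin n) (MvPolynomial (Fin n) k)) ∈
      RingHom.ker (reesPresentation (monomials k w)) := by
    obtain ⟨θ, hθ⟩ := hwv
    rw [RingHom.mem_ker, map_sub, reesPresentation_monomial, reesPresentation_monomial, hd, hd,
      hθ, hθ, add_left_comm, add_left_comm (single f 1), add_comm (single e 1), sub_self]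
  have hisol : ∀ j, v f j ≠ 0 → ∀ b, w b ≤ w j + single e 1 → b = j := by
    intro j hj b hb
    obtain ⟨ε, hε⟩ := exists_add_of_le hb
    have hε1 : ε.degree = 1 := by
      have := congrArg Finsupp.degree hε
      rw [map_add, map_add, hwd, hwd, Finsupp.degree_single] at this
      omega
    obtain ⟨g, rfl⟩ := exists_eq_single_one hε1
    have hsw : single b 1 + v g = single j 1 + v e := by
      simpa using fiber_swap hvw (α := single g 1) (β := single b 1) (α' := single e 1)
        (β' := single j 1) (by simp) (by
          rw [Finsupp.linearCombination_single, Finsupp.linearCombination_single, one_smul,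
            one_smul, add_comm, ← hε, add_comm])
    have hjf : single j 1 ≤ v f := by rw [Finsupp.single_le_iff]; omega
    have hle : v g ≤ v e + single j 1 := by
      rw [add_comm (v e), ← hsw]; exact le_add_self
    rcases eq_or_eq_of_le_add hd hinj hs hg (hle.trans (by gcongr)) with rfl | rfl
    · exact (Finsupp.single_left_inj one_ne_zero).mp (add_right_cancel hsw)
    · exfalso
      apply not_le_single (hd g) j
      intro i
      have := hle i
      simp only [Finsupp.add_apply] at this
      rcases hs i with h0 | h0 <;> omega
  have key : ∀ p ∈ linearRelations (monomials k w),
      ∀ q : MvPolynomial (Fin n) (MvPolynomial (Fin n) k),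
        coeff (single e 1) (coeff (v f) (q * p)) = 0 := by
    intro p hp
    induction hp using Submodule.span_induction with
    | zero => simp
    | add a b _ _ ha hb =>
      intro q
      rw [mul_add, MvPolynomial.coeff_add, MvPolynomial.coeff_add, ha, hb, add_zero]
    | smul r a _ ha => intro q; rw [smul_eq_mul, ← mul_assoc]; exact ha _
    | mem p hp =>
      obtain ⟨a, ha, rfl⟩ := hp
      intro q
      rw [Fintype.linearCombination_apply, Finset.mul_sum, MvPolynomial.coeff_sum,
        MvPolynomial.coeff_sum]
      refine Finset.sum_eq_zero fun j _ => ?_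
      rw [mul_smul_comm, MvPolynomial.coeff_smul, MvPolynomial.coeff_mul_X', smul_eq_mul]
      split_ifs with hj
      · rw [MvPolynomial.coeff_mul]
        refine Finset.sum_eq_zero fun x hx => ?_
        rw [Finset.HasAntidiagonal.mem_antidiagonal] at hx
        rw [coeff_eq_zero_of_isolated (mem_ker_linearCombination_monomials.mp ha), zero_mul]
        intro b hb
        refine hisol j (by simpa using hj) b (hb.trans ?_)
        gcongr
        rw [← hx]
        exact le_self_add
      · simp
  have := key _ (h hP) 1
  simp [MvPolynomial.coeff_monomial, hef] at this

end MonomialRees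

/-! ### Self-maps of a finite set with one periodic orbit -/

section SelfMaps

variable {α : Type*} {f : α → α}

lemma exists_iterate_mem_periodicPts [Finite α] (f : α → α) (a : α) :
    ∃ m, f^[m] a ∈ Function.periodicPts f := by
  obtain ⟨i, j, hij, h⟩ := Finite.exists_ne_map_eq_of_infinite fun m : ℕ => f^[m] a
  wlog hlt : i < j generalizing i j
  · exact this j i hij.symm h.symm (by omega)
  refine ⟨i, Function.mk_mem_periodicPts (n := j - i) (by omega) ?_⟩
  change f^[j - i] (f^[i] a) = f^[i] a
  rw [← Function.iterate_add_apply, Nat.sub_add_cancel hlt.le]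
  exact h.symm

lemma map_mem_periodicPts {a : α} (h : a ∈ Function.periodicPts f) :
    f a ∈ Function.periodicPts f :=
  (Function.bijOn_periodicPts f).mapsTo h

lemma iterate_mem_periodicPts {a : α} (h : a ∈ Function.periodicPts f) (m : ℕ) :
    f^[m] a ∈ Function.periodicPts f :=
  (Function.bijOn_periodicPts f).mapsTo.iterate m h

lemma iterate_mem_periodicPts_of_le {a : α} {s t : ℕ} (hst : s ≤ t)
    (h : f^[s] a ∈ Function.periodicPts f) : f^[t] a ∈ Function.periodicPts f := by
  obtain ⟨d, rfl⟩ := Nat.exists_eq_add_of_le hst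
  rw [add_comm, Function.iterate_add_apply]
  exact iterate_mem_periodicPts h d

/-- The edges `{a, f a}` and `{b, f b}` have a common end or are joined by a third edge. -/
def IsGapFreeMap (f : α → α) : Prop :=
  ∀ a b, a = b ∨ a = f b ∨ b = f a ∨ f a = f b ∨ f (f b) = a ∨ f (f a) = b ∨ f (f a) = f b ∨
    f (f b) = f a

/-- Walking along the orbit towards the cycle passes through a point at distance exactly `t + 1`, so
violations of a depth bound can be tested there. -/
lemma exists_last_notMem [Finite α] {a : α} {t : ℕ} (h : f^[t] a ∉ Function.periodicPts f) :
    ∃ b, f^[t] b ∉ Function.periodicPts f ∧ f^[t + 1] b ∈ Function.periodicPts f := by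
  classical
  have hex : ∃ m, f^[m] (f^[t] a) ∈ Function.periodicPts f := exists_iterate_mem_periodicPts f _
  obtain ⟨m, hm⟩ := Nat.exists_eq_succ_of_ne_zero (n := Nat.find hex) (by
    intro h0
    have := Nat.find_spec hex
    rw [h0] at this
    exact h this)
  refine ⟨f^[m] a, ?_, ?_⟩
  · have := Nat.find_min hex (m := m) (by omega)
    rwa [← Function.iterate_add_apply, add_comm, Function.iterate_add_apply] at this
  · have := Nat.find_spec hex
    rw [hm, ← Function.iterate_add_apply] at this
    rw [← Function.iterate_add_apply]
    convert this using 2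
    omega

theorem isGapFreeMap_iff [Finite α] [Nonempty α] {r : ℕ} (hodd : Odd r)
    (hper : ∀ p ∈ Function.periodicPts f, Function.minimalPeriod f p = r)
    (horb : ∀ p ∈ Function.periodicPts f, ∀ q ∈ Function.periodicPts f, ∃ i < r, q = f^[i] p) :
    IsGapFreeMap f ↔
      (r = 1 ∧ (∀ a, f^[2] a ∈ Function.periodicPts f) ∧
        ∀ y y', y ∉ Function.periodicPts f → y' ∉ Function.periodicPts f →
          y ∈ Set.range f → y' ∈ Set.range f → y = y') ∨
      (r = 3 ∧ ∀ a, f^[1] a ∈ Function.periodicPts f) ∨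
      (r = 5 ∧ ∀ a, f^[0] a ∈ Function.periodicPts f) := by
  set P := Function.periodicPts f with hP
  obtain ⟨p, hp⟩ : ∃ p, p ∈ P :=
    ⟨_, (exists_iterate_mem_periodicPts f (Classical.arbitrary α)).choose_spec⟩
  have hf : ∀ {a}, a ∈ P → f a ∈ P := map_mem_periodicPts
  have hne : ∀ {q}, q ∈ P → ∀ {i j : ℕ}, i < r → j < r → i ≠ j → f^[i] q ≠ f^[j] q := by
    intro q hq i j hi hj hij h
    have hr := hper q hq
    exact hij (Function.iterate_injOn_Iio_minimalPeriod (f := f) (x := q)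
      (by simpa [hr] using hi) (by simpa [hr] using hj) h)
  have hcyc : ∀ {q}, q ∈ P → f^[r] q = q := by
    intro q hq
    rw [← hper q hq]
    exact Function.iterate_minimalPeriod
  constructor
  · intro h
    by_cases h7 : 7 ≤ r
    · exfalso
      have ne : ∀ {i j : ℕ}, i < 7 → j < 7 → i ≠ j → f^[i] p ≠ f^[j] p :=
        fun hi hj hij => hne hp (by omega) (by omega) hij
      -- On a cycle of length at least 7, the edges starting at positions 0 and 3 form a gap.
      rcases h p (f^[3] p) with h | h | h | h | h | h | h | h
      · exact ne (i := 0) (j := 3) (by omega) (by omega) (by omega) h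
      · exact ne (i := 0) (j := 4) (by omega) (by omega) (by omega) h
      · exact ne (i := 3) (j := 1) (by omega) (by omega) (by omega) h
      · exact ne (i := 1) (j := 4) (by omega) (by omega) (by omega) h
      · exact ne (i := 5) (j := 0) (by omega) (by omega) (by omega) h
      · exact ne (i := 2) (j := 3) (by omega) (by omega) (by omega) h
      · exact ne (i := 2) (j := 4) (by omega) (by omega) (by omega) h
      · exact ne (i := 5) (j := 1) (by omega) (by omega) (by omega) h
    have hr : r = 1 ∨ r = 3 ∨ r = 5 := by
      obtain ⟨m, rfl⟩ := hodd
      omega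
    rcases hr with rfl | rfl | rfl
    · left
      have h2 : ∀ a, f^[2] a ∈ P := by
        intro a
        by_contra ha
        obtain ⟨b, hb, hb'⟩ := exists_last_notMem ha
        have hb1 : f b ∉ P := fun hh => hb (hf hh)
        have hb0 : b ∉ P := fun hh => hb1 (hf hh)
        -- The loop at `p` and an edge with both ends at distance at least 2 form a gap.
        rcases h b p with h | h | h | h | h | h | h | h
        · exact hb0 (h ▸ hp)
        · exact hb0 (h ▸ hf hp)
        · exact hb1 (h ▸ hp)
        · exact hb1 (h ▸ hf hp)
        · exact hb0 (h ▸ hf (hf hp))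
        · exact hb (show f (f b) ∈ P from h ▸ hp)
        · exact hb (show f (f b) ∈ P from h ▸ hf hp)
        · exact hb1 (h ▸ hf (hf hp))
      refine ⟨rfl, h2, ?_⟩
      rintro _ _ hy hy' ⟨a, rfl⟩ ⟨b, rfl⟩
      have h2a : f (f a) ∈ P := h2 a
      have h2b : f (f b) ∈ P := h2 b
      rcases h a b with h | h | h | h | h | h | h | h
      · rw [h]
      · exact absurd (h ▸ h2b) hy
      · exact absurd (h ▸ h2a) hy'
      · exact h
      · exact absurd (hf (h ▸ h2b)) hy
      · exact absurd (hf (h ▸ h2a)) hy'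
      · exact absurd (h ▸ h2a) hy'
      · exact absurd (h ▸ h2b) hy
    · right; left
      refine ⟨rfl, fun a => ?_⟩
      by_contra ha
      obtain ⟨b, hb, hb'⟩ := exists_last_notMem ha
      have hb1 : f b ∉ P := hb
      have hb0 : b ∉ P := fun hh => hb1 (hf hh)
      have hx : f (f b) ∈ P := hb'
      -- With $x=f^2(b)$ the point where the path enters the triangle, the edge opposite to $x$ and
      -- $\{b,f(b)\}$ form a gap.
      rcases h b (f (f (f b))) with h | h | h | h | h | h | h | h
      · exact hb0 (h ▸ hf hx)
      · exact hb0 (h ▸ hf (hf hx))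
      · exact hb1 (h ▸ hf hx)
      · exact hb1 (h ▸ hf (hf hx))
      · exact hb0 (h ▸ hf (hf (hf hx)))
      · exact hne hx (i := 0) (j := 1) (by omega) (by omega) (by omega) h
      · exact hne hx (i := 0) (j := 2) (by omega) (by omega) (by omega) h
      · exact hb1 (h ▸ hf (hf (hf hx)))
    · right; right
      refine ⟨rfl, fun a => ?_⟩
      by_contra ha
      obtain ⟨b, hb, hb'⟩ := exists_last_notMem ha
      have hb0 : b ∉ P := hb
      have hx : f b ∈ P := hb'
      -- With $x=f(b)$ on the pentagon, the edge $\{f^2(x),f^3(x)\}$ opposite to $x$ and $\{b,x\}$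
      -- form a gap.
      rcases h b (f (f (f b))) with h | h | h | h | h | h | h | h
      · exact hb0 (h ▸ hf (hf hx))
      · exact hb0 (h ▸ hf (hf (hf hx)))
      · exact hne hx (i := 2) (j := 0) (by omega) (by omega) (by omega) h
      · exact hne hx (i := 0) (j := 3) (by omega) (by omega) (by omega) h
      · exact hb0 (h ▸ hf (hf (hf (hf hx))))
      · exact hne hx (i := 1) (j := 2) (by omega) (by omega) (by omega) h
      · exact hne hx (i := 1) (j := 3) (by omega) (by omega) (by omega) h
      · exact hne hx (i := 4) (j := 0) (by omega) (by omega) (by omega) h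
  · rintro (⟨rfl, h2, hs⟩ | ⟨rfl, h1⟩ | ⟨rfl, h0⟩) a b
    · have hfix : ∀ {q}, q ∈ P → q = p := by
        intro q hq
        obtain ⟨i, hi, rfl⟩ := horb p hp q hq
        rw [Nat.lt_one_iff.mp hi]
        rfl
      have ha : f (f a) = p := hfix (h2 a)
      have hb : f (f b) = p := hfix (h2 b)
      by_cases hfa : f a ∈ P <;> by_cases hfb : f b ∈ P
      · simp [hfix hfa, hfix hfb]
      · simp [hfix hfa, hb]
      · simp [hfix hfb, ha]
      · simp [hs _ _ hfa hfb ⟨a, rfl⟩ ⟨b, rfl⟩]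
    · have ha : f a ∈ P := h1 a
      obtain ⟨i, hi, h⟩ := horb _ ha _ (h1 b)
      have hc : f (f (f (f a))) = f a := hcyc ha
      have h : f b = f^[i] (f a) := h
      interval_cases i
      · simp [show f b = f a from h]
      · simp [show f b = f (f a) from h]
      · simp [show f b = f (f (f a)) from h, hc]
    · have ha : a ∈ P := h0 a
      obtain ⟨i, hi, h⟩ := horb _ ha _ (h0 b)
      have hc : f (f (f (f (f a)))) = a := hcyc ha
      have h : b = f^[i] a := h
      interval_cases i
      · simp [show b = a from h]
      · simp [show b = f a from h]
      · simp [show b = f (f a) from h]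
      · simp [show b = f (f (f a)) from h, hc]
      · simp [show b = f (f (f (f a))) from h, hc]

end SelfMaps

/-! ### The graph of a set of quadratic monomials -/

section GraphOf

variable {n : ℕ} {v : Fin n → Fin n →₀ ℕ}

lemma graphOf_isLink {e a b : Fin n} :
    (graphOf v).IsLink e a b ↔ v e = single a 1 + single b 1 := Iff.rfl

lemma graphOf_inc (hd : ∀ j, (v j).degree = 2) {e x : Fin n} :
    (graphOf v).Inc e x ↔ v e x ≠ 0 := by
  constructor
  · rintro ⟨y, hy⟩
    rw [graphOf_isLink] at hy
    simp [hy]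
  · intro h
    exact exists_eq_single_add_single (hd e) h

lemma exists_apply_ne_zero (hd : ∀ j, (v j).degree = 2) (e : Fin n) : ∃ x, v e x ≠ 0 := by
  by_contra! hcon
  have : v e = 0 := by ext i; simp [hcon]
  have h2 := hd e
  rw [this] at h2
  simp at h2

lemma mem_edgeSet_graphOf (hd : ∀ j, (v j).degree = 2) (e : Fin n) :
    e ∈ (graphOf v).edgeSet := by
  obtain ⟨x, hx⟩ := exists_apply_ne_zero hd e
  exact ((graphOf_inc hd).mpr hx).edge_mem

lemma ediam_edgeGraph_le_two_iff (hd : ∀ j, (v j).degree = 2) :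
    (edgeGraph (graphOf v)).ediam ≤ 2 ↔ IsGapFree v := by
  rw [SimpleGraph.ediam_le_iff]
  constructor
  · intro h e f
    have hle := h ⟨e, mem_edgeSet_graphOf hd e⟩ ⟨f, mem_edgeSet_graphOf hd f⟩
    obtain ⟨p, hp⟩ := SimpleGraph.exists_walk_of_edist_ne_top
      (ne_top_of_le_ne_top (ENat.natCast_ne_top 2) hle)
    rw [← hp] at hle
    have hlen : p.length ≤ 2 := by exact_mod_cast hle
    have share : ∀ {a b : (graphOf v).edgeSet}, (edgeGraph (graphOf v)).Adj a b →
        ∃ x, v a x ≠ 0 ∧ v b x ≠ 0 := by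
      rintro a b ⟨-, x, hx, hx'⟩
      exact ⟨x, (graphOf_inc hd).mp hx, (graphOf_inc hd).mp hx'⟩
    match p, hlen with
    | .nil, _ =>
      obtain ⟨x, hx⟩ := exists_apply_ne_zero hd e
      exact Or.inl ⟨x, hx, hx⟩
    | .cons h .nil, _ => exact Or.inl (share h)
    | .cons (v := g) h (.cons h' .nil), _ =>
      obtain ⟨x, hx, hx'⟩ := share h
      obtain ⟨y, hy, hy'⟩ := share h'
      -- A middle edge that meets both outer edges at the same vertex is not a joining edge, but
      -- then the outer edges share that vertex.
      by_cases hxy : x = y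
      · subst hxy
        exact Or.inl ⟨x, hx, hy'⟩
      · right
        obtain ⟨z, hz⟩ := exists_eq_single_add_single (hd g) hx'
        refine ⟨g, x, y, hx, hy', ?_⟩
        have : z = y := by
          by_contra hne
          rw [hz] at hy
          simp [hxy, hne] at hy
        rw [hz, this]
    | .cons _ (.cons _ (.cons _ _)), hl => simp only [SimpleGraph.Walk.length_cons] at hl; omega
  · rintro h ⟨e, he⟩ ⟨f, hf⟩
    have adj : ∀ (a b : (graphOf v).edgeSet), (∃ x, v a x ≠ 0 ∧ v b x ≠ 0) → a ≠ b →
        (edgeGraph (graphOf v)).Adj a b := by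
      rintro a b ⟨x, hx, hx'⟩ hab
      exact ⟨hab, x, (graphOf_inc hd).mpr hx, (graphOf_inc hd).mpr hx'⟩
    have walk : ∀ p : (edgeGraph (graphOf v)).Walk ⟨e, he⟩ ⟨f, hf⟩, p.length ≤ 2 →
        (edgeGraph (graphOf v)).edist ⟨e, he⟩ ⟨f, hf⟩ ≤ 2 := by
      intro p hp
      refine (SimpleGraph.Walk.edist_le p).trans ?_
      exact_mod_cast hp
    by_cases hef : e = f
    · subst hef
      simp
    by_cases hs : ∃ x, v e x ≠ 0 ∧ v f x ≠ 0
    · exact walk (.cons (adj _ _ hs (by simpa using hef)) .nil) (by simp)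
    · obtain ⟨g, a, b, ha, hb, hg⟩ := (h e f).resolve_left hs
      have hga : v g a ≠ 0 := by simp [hg]
      have hgb : v g b ≠ 0 := by simp [hg]
      refine walk (.cons (v := ⟨g, mem_edgeSet_graphOf hd g⟩) (adj _ _ ⟨a, ha, hga⟩ ?_)
        (.cons (adj _ _ ⟨b, hgb, hb⟩ ?_) .nil)) (by simp)
      · rintro h
        obtain rfl : e = g := congrArg Subtype.val h
        exact hs ⟨b, hgb, hb⟩
      · rintro h
        obtain rfl : g = f := congrArg Subtype.val h
        exact hs ⟨a, ha, hga⟩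

/-- A nonzero determinant matches the edges with one of their ends each. -/
lemma exists_matching (hd : ∀ j, (v j).degree = 2) (hdet : (exponentMatrix v).det ≠ 0) :
    ∃ (σ : Equiv.Perm (Fin n)) (f : Fin n → Fin n),
      ∀ i, v (σ i) = single i 1 + single (f i) 1 := by
  rw [Matrix.det_apply] at hdet
  obtain ⟨σ, -, hσ⟩ := Finset.exists_ne_zero_of_sum_ne_zero hdet
  have hne : ∀ i, v (σ i) i ≠ 0 := by
    intro i h
    apply hσ
    rw [Finset.prod_eq_zero (Finset.mem_univ i), smul_zero]
    simp [exponentMatrix, h]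
  choose f hf using fun i => exists_eq_single_add_single (hd (σ i)) (hne i)
  exact ⟨σ, f, hf⟩

/-- The alternating sum along a circuit. -/
lemma IsCircuit.exists_vecMul_eq (hinj : ∀ z, Matrix.vecMul z (exponentMatrix v) = 0 → z = 0)
    {r : ℕ} {C : Set (Fin n)} (h : IsCircuit (graphOf v) r C) :
    Odd r ∧ ∃ (c : Fin n → ℤ) (a : Fin n),
      Matrix.vecMul c (exponentMatrix v) = (2 : ℤ) • Pi.single a 1 ∧ ∀ j, j ∈ C ↔ Odd (c j) := by
  classical
  obtain ⟨hr, x, e, -, he, hl, rfl⟩ := h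
  obtain ⟨m, rfl⟩ := Nat.exists_eq_add_of_le' hr
  let c : Fin n → ℤ := ∑ i : Fin (m + 1), (-1 : ℤ) ^ (i : ℕ) • Pi.single (e i) 1
  have hce : ∀ i, c (e i) = (-1) ^ (i : ℕ) := by
    intro i
    simp only [c, Finset.sum_apply, Pi.smul_apply, Pi.single_apply, he.eq_iff, smul_eq_mul]
    simp
  have hcn : ∀ j, j ∉ Set.range e → c j = 0 := by
    intro j hj
    simp only [c, Finset.sum_apply, Pi.smul_apply, Pi.single_apply, smul_eq_mul]
    refine Finset.sum_eq_zero fun i _ => ?_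
    rw [if_neg, mul_zero]
    rintro rfl
    exact hj ⟨i, rfl⟩
  have hsum : Matrix.vecMul c (exponentMatrix v) =
      (1 - (-1 : ℤ) ^ (m + 1)) • Pi.single (x 0) 1 := by
    have hrow : ∀ i, Matrix.vecMul (Pi.single (e i) 1) (exponentMatrix v) =
        Pi.single (x i) 1 + Pi.single (x (i + 1)) 1 := by
      intro i
      have := hl i
      rw [graphOf_isLink, finRotate_apply] at this
      rw [intVec_row, this, intVec_add, intVec_single, intVec_single]
      simp
    simp only [c]
    rw [Matrix.sum_vecMul]
    simp only [Matrix.smul_vecMul, hrow]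
    -- The alternating sum telescopes; the index is read cyclically, so the last term comes back to
    -- `x 0` with sign $(-1)^{m+1}$.
    let g : ℕ → Fin n → ℤ := fun i => (-1 : ℤ) ^ i • Pi.single (x (Fin.ofNat (m + 1) i)) 1
    have hg : ∀ i : Fin (m + 1), (-1 : ℤ) ^ (i : ℕ) •
        ((Pi.single (x i) 1 + Pi.single (x (i + 1)) 1 : Fin n → ℤ)) = g i - g (i + 1) := by
      intro i
      have h1 : Fin.ofNat (m + 1) (i : ℕ) = i := by simp
      have h2 : Fin.ofNat (m + 1) ((i : ℕ) + 1) = i + 1 := by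
        ext; simp [Fin.val_add]
      simp only [g, h1, h2, pow_succ, smul_add]
      simp [sub_eq_add_neg]
    simp only [hg]
    rw [Fin.sum_univ_eq_sum_range (fun i => g i - g (i + 1)), Finset.sum_range_sub']
    have h1 : Fin.ofNat (m + 1) (m + 1) = 0 := by ext; simp
    have h0 : Fin.ofNat (m + 1) 0 = 0 := by ext; simp
    simp only [g, h0, h1, sub_smul, pow_zero]
  -- Along an even circuit the sum would be zero, a dependence among the rows.
  have hodd : Odd (m + 1) := by
    by_contra hev
    rw [Nat.not_odd_iff_even] at hev
    rw [hev.neg_one_pow, sub_self, zero_smul] at hsum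
    have := congrFun (hinj c hsum) (e 0)
    rw [hce] at this
    simp at this
  refine ⟨hodd, c, x 0, ?_, fun j => ?_⟩
  · rw [hsum, hodd.neg_one_pow]
    norm_num
  · constructor
    · rintro ⟨i, rfl⟩
      rw [hce]
      exact odd_neg_one.pow
    · intro hj
      by_contra hcon
      rw [hcn j hcon] at hj
      simp at hj

/-- Two circuits give $cV=2e_a$ and $c'V=2e_{a'}$, while $e_a-e_{a'}=zV$ with $z$ integral. Hence
$c-c'=2z$, and a circuit is the set of odd coefficients. -/
lemma IsCremonaSet.isCircuit_unique {k : Type*} [Field k] (hv : IsCremonaSet k v 2)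
    {r r' : ℕ} {C C' : Set (Fin n)} (h : IsCircuit (graphOf v) r C)
    (h' : IsCircuit (graphOf v) r' C') : r' = r ∧ C' = C := by
  have hinj : ∀ z, Matrix.vecMul z (exponentMatrix v) = 0 → z = 0 := fun z hz =>
    hv.vecMul_injective (hz.trans (Matrix.zero_vecMul _).symm)
  have hC : C' = C := by
    obtain ⟨-, c, a, hc, hmem⟩ := h.exists_vecMul_eq hinj
    obtain ⟨-, c', a', hc', hmem'⟩ := h'.exists_vecMul_eq hinj
    obtain ⟨z, hz⟩ := hv.exists_vecMul_eq_single_sub a a'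
    have hcc : c - c' = (2 : ℤ) • z := by
      apply hv.vecMul_injective
      rw [Matrix.sub_vecMul, hc, hc', Matrix.smul_vecMul, hz, smul_sub]
    ext j
    rw [hmem, hmem']
    have := congrFun hcc j
    simp only [Pi.sub_apply, Pi.smul_apply, smul_eq_mul] at this
    have h1 : c j = 2 * z j + c' j := by omega
    rw [h1, Int.odd_iff, Int.odd_iff]
    omega
  have hcard : ∀ {r : ℕ} {C : Set (Fin n)}, IsCircuit (graphOf v) r C → C.ncard = r := by
    rintro r C ⟨-, x, e, -, he, -, rfl⟩
    rw [← Set.image_univ, Set.ncard_image_of_injective _ he, Set.ncard_univ, Nat.card_fin]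
  exact ⟨by rw [← hcard h, ← hcard h', hC], hC⟩

end GraphOf

/-! ### The graph in terms of a self-map whose arrows are the edges -/

section Matching

variable {n : ℕ} {v : Fin n → Fin n →₀ ℕ} {σ : Equiv.Perm (Fin n)} {f : Fin n → Fin n}

lemma isLink_matching (hσ : ∀ i, v (σ i) = single i 1 + single (f i) 1) {c x y : Fin n} :
    (graphOf v).IsLink (σ c) x y ↔ (c = x ∧ f c = y) ∨ (c = y ∧ f c = x) :=
  Graph.IsLink.isLink_iff (G := graphOf v) (graphOf_isLink.mpr (hσ c))

lemma inc_matching (hσ : ∀ i, v (σ i) = single i 1 + single (f i) 1) {c x : Fin n} :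
    (graphOf v).Inc (σ c) x ↔ x = c ∨ x = f c := by
  simp only [Graph.Inc, isLink_matching hσ]
  grind

lemma apply_ne_zero_matching (hσ : ∀ i, v (σ i) = single i 1 + single (f i) 1) {c x : Fin n} :
    v (σ c) x ≠ 0 ↔ x = c ∨ x = f c := by
  rw [hσ]
  simp only [Finsupp.add_apply, Finsupp.single_apply]
  grind

lemma exists_isLink_matching (hσ : ∀ i, v (σ i) = single i 1 + single (f i) 1) {x y : Fin n} :
    (∃ e, (graphOf v).IsLink e x y) ↔ f x = y ∨ f y = x := by
  constructor
  · rintro ⟨e, he⟩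
    obtain ⟨c, rfl⟩ := σ.surjective e
    rcases (isLink_matching hσ).mp he with ⟨rfl, h⟩ | ⟨rfl, h⟩
    · exact Or.inl h
    · exact Or.inr h
  · rintro (h | h)
    · exact ⟨σ x, (isLink_matching hσ).mpr (Or.inl ⟨rfl, h⟩)⟩
    · exact ⟨σ y, (isLink_matching hσ).mpr (Or.inr ⟨rfl, h⟩)⟩

lemma isGapFree_iff_isGapFreeMap (hσ : ∀ i, v (σ i) = single i 1 + single (f i) 1) :
    IsGapFree v ↔ IsGapFreeMap f := by
  have main : IsGapFree v ↔ ∀ a b, (∃ u, (u = a ∨ u = f a) ∧ (u = b ∨ u = f b)) ∨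
      ∃ x y, (x = a ∨ x = f a) ∧ (y = b ∨ y = f b) ∧ (f x = y ∨ f y = x) := by
    rw [IsGapFree, ← σ.forall_congr_right]
    refine forall_congr' fun a => ?_
    rw [← σ.forall_congr_right]
    refine forall_congr' fun b => ?_
    simp only [apply_ne_zero_matching hσ, ← exists_isLink_matching hσ, graphOf_isLink]
    refine or_congr Iff.rfl ⟨?_, ?_⟩
    · rintro ⟨g, x, y, hx, hy, hg⟩
      exact ⟨x, y, hx, hy, g, hg⟩
    · rintro ⟨x, y, hx, hy, g, hg⟩
      exact ⟨g, x, y, hx, hy, hg⟩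
  rw [main, IsGapFreeMap]
  refine forall_congr' fun a => forall_congr' fun b => ?_
  constructor
  · rintro (⟨u, rfl | rfl, h | h⟩ | ⟨x, y, rfl | rfl, rfl | rfl, h | h⟩) <;> simp_all
  · rintro (h | h | h | h | h | h | h | h)
    · exact Or.inl ⟨a, Or.inl rfl, Or.inl h⟩
    · exact Or.inl ⟨a, Or.inl rfl, Or.inr h⟩
    · exact Or.inl ⟨b, Or.inr h, Or.inl rfl⟩
    · exact Or.inl ⟨f a, Or.inr rfl, Or.inr h⟩
    · exact Or.inr ⟨a, f b, Or.inl rfl, Or.inr rfl, Or.inr h⟩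
    · exact Or.inr ⟨f a, b, Or.inr rfl, Or.inl rfl, Or.inl h⟩
    · exact Or.inr ⟨f a, f b, Or.inr rfl, Or.inr rfl, Or.inl h⟩
    · exact Or.inr ⟨f a, f b, Or.inr rfl, Or.inr rfl, Or.inr h⟩

lemma isCircuit_of_mem_periodicPts (hσ : ∀ i, v (σ i) = single i 1 + single (f i) 1)
    {p : Fin n} (hp : p ∈ Function.periodicPts f) :
    IsCircuit (graphOf v) (Function.minimalPeriod f p)
      (Set.range fun i : Fin (Function.minimalPeriod f p) => σ (f^[i] p)) := by
  have hpos := Function.minimalPeriod_pos_of_mem_periodicPts hp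
  have hinj : Function.Injective fun i : Fin (Function.minimalPeriod f p) => f^[i] p := by
    intro i j hij
    exact Fin.ext (Function.iterate_injOn_Iio_minimalPeriod i.2 j.2 hij)
  have hlink : ∀ (r : ℕ), r = Function.minimalPeriod f p → 1 ≤ r → ∀ i : Fin r,
      (graphOf v).IsLink (σ (f^[i] p)) (f^[i] p) (f^[finRotate r i] p) := by
    intro r hr h1 i
    obtain ⟨m, rfl⟩ := Nat.exists_eq_add_of_le' h1
    rw [isLink_matching hσ, finRotate_apply]
    left
    refine ⟨rfl, ?_⟩
    have : ((i + 1 : Fin (m + 1)) : ℕ) = ((i : ℕ) + 1) % Function.minimalPeriod f p := by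
      rw [← hr]
      simp [Fin.val_add]
    rw [this, Function.iterate_mod_minimalPeriod_eq, Function.iterate_succ_apply']
  exact ⟨hpos, fun i => f^[i] p, fun i => σ (f^[i] p), hinj, σ.injective.comp hinj,
    hlink _ rfl hpos, rfl⟩

/-- If the circuit is unique, it consists of the periodic points, which form one orbit. -/
lemma IsCircuit.eq_periodicPts (hσ : ∀ i, v (σ i) = single i 1 + single (f i) 1)
    {r : ℕ} {C : Set (Fin n)}
    (hu : ∀ r' C', IsCircuit (graphOf v) r' C' → r' = r ∧ C' = C)
    (hne : ∃ p, p ∈ Function.periodicPts f) :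
    (∀ p ∈ Function.periodicPts f, Function.minimalPeriod f p = r) ∧
    (∀ p ∈ Function.periodicPts f, ∀ q ∈ Function.periodicPts f, ∃ i < r, q = f^[i] p) ∧
    vertexSupport (graphOf v) C = Function.periodicPts f := by
  have h := fun p hp => hu _ _ (isCircuit_of_mem_periodicPts hσ (p := p) hp)
  have hper := fun p hp => (h p hp).1
  have horb : ∀ p ∈ Function.periodicPts f, ∀ q ∈ Function.periodicPts f,
      ∃ i < r, q = f^[i] p := by
    intro p hp q hq
    have hqC : σ q ∈ C := by
      rw [← (h q hq).2]
      exact ⟨⟨0, Function.minimalPeriod_pos_of_mem_periodicPts hq⟩, rfl⟩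
    rw [← (h p hp).2] at hqC
    obtain ⟨i, hi⟩ := hqC
    exact ⟨i, by rw [← hper p hp]; exact i.2, (σ.injective hi).symm⟩
  refine ⟨hper, horb, ?_⟩
  ext x
  constructor
  · rintro ⟨e, he, hx⟩
    obtain ⟨p, hp⟩ := hne
    rw [← (h p hp).2] at he
    obtain ⟨i, rfl⟩ := he
    have hi := iterate_mem_periodicPts hp (i : ℕ)
    rcases (inc_matching hσ).mp hx with rfl | rfl
    · exact hi
    · exact map_mem_periodicPts hi
  · intro hx
    refine ⟨σ x, ?_, (inc_matching hσ).mpr (Or.inl rfl)⟩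
    rw [← (h x hx).2]
    exact ⟨⟨0, Function.minimalPeriod_pos_of_mem_periodicPts hx⟩, rfl⟩

/-- The distance to the circuit is the number of steps until the self-map reaches it. -/
lemma distToCircuit_le_iff (hσ : ∀ i, v (σ i) = single i 1 + single (f i) 1) {C : Set (Fin n)}
    (hC : vertexSupport (graphOf v) C = Function.periodicPts f) {a : Fin n} {t : ℕ} :
    distToCircuit (graphOf v) C a ≤ t ↔ f^[t] a ∈ Function.periodicPts f := by
  rw [distToCircuit, hC]
  constructor
  · intro h
    have hlt : (⨅ y ∈ Function.periodicPts f, (underlyingGraph (graphOf v)).edist y a) <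
        ((t + 1 : ℕ) : ℕ∞) := lt_of_le_of_lt h (by exact_mod_cast Nat.lt_succ_self t)
    simp only [iInf_lt_iff] at hlt
    obtain ⟨y, hy, hlt⟩ := hlt
    rw [SimpleGraph.edist_comm] at hlt
    obtain ⟨p, hp⟩ := SimpleGraph.exists_walk_of_edist_ne_top hlt.ne_top
    rw [← hp] at hlt
    have hlen : p.length ≤ t := by
      have : p.length < t + 1 := by exact_mod_cast hlt
      omega
    refine iterate_mem_periodicPts_of_le hlen ?_
    clear hlen hlt hp h
    induction p with
    | nil => exact hy
    | cons hadj p ih =>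
      have := ih hy
      rw [SimpleGraph.Walk.length_cons, Function.iterate_succ_apply]
      -- A step of the walk either follows `f` or goes against it. In the second case the start is
      -- the image of the next vertex, so iterates from it are further along the same orbit.
      rcases (exists_isLink_matching hσ).mp hadj.2 with h | h
      · rw [h]; exact this
      · rw [← h, ← Function.iterate_succ_apply, ← Function.iterate_succ_apply]
        exact iterate_mem_periodicPts_of_le (by omega) this
  · intro h
    refine (iInf₂_le _ h).trans ?_
    clear h
    induction t generalizing a with
    | zero => simp
    | succ t ih =>
      rw [Function.iterate_succ_apply]
      refine (SimpleGraph.edist_triangle (v := f a)).trans ?_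
      push_cast
      gcongr
      · exact ih
      · by_cases hfa : f a = a
        · simp [hfa]
        · have hadj : (underlyingGraph (graphOf v)).Adj (f a) a :=
            ⟨hfa, (exists_isLink_matching hσ).mpr (Or.inr rfl)⟩
          exact (SimpleGraph.edist_eq_one_iff_adj.mpr hadj).le

/-- If `a` has distance `d > J`, then `f a` has distance `d - 1`, so the edge `σ a` lies in the
`d`-th neighborhood. The shift to `J + 1` appears because the `j`-th neighborhood reaches the
vertices at distance `j`. -/
lemma neighborhoodSize_eq_zero_iff (hσ : ∀ i, v (σ i) = single i 1 + single (f i) 1)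
    {C : Set (Fin n)} (hC : vertexSupport (graphOf v) C = Function.periodicPts f) (J : ℕ) :
    (∀ j ≥ J + 1, neighborhoodSize (graphOf v) C j = 0) ↔
      ∀ a, f^[J] a ∈ Function.periodicPts f := by
  have hle := fun a t => distToCircuit_le_iff hσ hC (a := a) (t := t)
  constructor
  · intro h a
    by_contra ha
    rw [← hle, not_le] at ha
    have hfin : ∀ b, ∃ d : ℕ, distToCircuit (graphOf v) C b = d := by
      intro b
      obtain ⟨m, hm⟩ := exists_iterate_mem_periodicPts f b
      obtain ⟨d, hd⟩ := ENat.ne_top_iff_exists.mp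
        (ne_top_of_le_ne_top (ENat.natCast_ne_top m) ((hle b m).mpr hm))
      exact ⟨d, hd.symm⟩
    obtain ⟨d, hd⟩ := hfin a
    obtain ⟨t, ht⟩ := hfin (f a)
    have hJd : J < d := by rw [hd] at ha; exact_mod_cast ha
    obtain ⟨d, rfl⟩ := Nat.exists_eq_succ_of_ne_zero (n := d) (by omega)
    have h1 : t ≤ d := by
      have := (hle (f a) d).mpr (by
        rw [← Function.iterate_succ_apply]
        exact (hle a (d + 1)).mp hd.le)
      rw [ht] at this
      exact_mod_cast this
    have h2 : d + 1 ≤ t + 1 := by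
      have := (hle a (t + 1)).mpr (by
        rw [Function.iterate_succ_apply]
        exact (hle (f a) t).mp ht.le)
      rw [hd] at this
      exact_mod_cast this
    obtain rfl : t = d := by omega
    have h0 := h (t + 1) (by omega)
    rw [neighborhoodSize, Set.ncard_eq_zero] at h0
    have : σ a ∈ (∅ : Set (Fin n)) := by
      rw [← h0]
      exact ⟨f a, a, (isLink_matching hσ).mpr (Or.inr ⟨rfl, rfl⟩), by rw [ht]; norm_cast, hd⟩
    exact this
  · intro h j hj
    rw [neighborhoodSize, Set.ncard_eq_zero, Set.eq_empty_iff_forall_notMem]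
    rintro e ⟨x, y, -, -, hy⟩
    have := (hle y J).mpr (h y)
    rw [hy] at this
    have : j ≤ J := by exact_mod_cast this
    omega

/-- A vertex off the circuit carries no loop and always has its own edge `σ x`; any further edge at
it is `σ c` with `f c = x`. -/
lemma two_le_vertexDegree_iff (hσ : ∀ i, v (σ i) = single i 1 + single (f i) 1) {x : Fin n}
    (hx : x ∉ Function.periodicPts f) : 2 ≤ vertexDegree (graphOf v) x ↔ x ∈ Set.range f := by
  have hfx : ∀ {c}, f c = x → c ≠ x := by
    rintro c hc rfl
    exact hx (Function.mk_mem_periodicPts (n := 1) one_pos hc)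
  have hloop : (graphOf v).loopSet x = ∅ := by
    rw [Set.eq_empty_iff_forall_notMem]
    intro e he
    obtain ⟨c, rfl⟩ := σ.surjective e
    rcases (isLink_matching hσ).mp he with ⟨rfl, h⟩ | ⟨rfl, h⟩ <;> exact hfx h rfl
  rw [vertexDegree, hloop, Set.ncard_empty, add_zero]
  constructor
  · intro h
    obtain ⟨e, e', he, he', hne⟩ := (Set.one_lt_ncard_iff).mp h
    obtain ⟨c, rfl⟩ := σ.surjective e
    obtain ⟨c', rfl⟩ := σ.surjective e'
    rcases (inc_matching hσ).mp he with rfl | rfl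
    · rcases (inc_matching hσ).mp he' with rfl | rfl
      · exact absurd rfl hne
      · exact ⟨c', rfl⟩
    · exact ⟨c, rfl⟩
  · rintro ⟨c, rfl⟩
    refine (Set.one_lt_ncard_iff).mpr ⟨σ (f c), σ c, (inc_matching hσ).mpr (Or.inl rfl),
      (inc_matching hσ).mpr (Or.inr rfl), fun h => hfx rfl (σ.injective h).symm⟩

lemma offCircuitBranching_le_one_iff (hσ : ∀ i, v (σ i) = single i 1 + single (f i) 1)
    {C : Set (Fin n)} (hC : vertexSupport (graphOf v) C = Function.periodicPts f) :
    offCircuitBranching (graphOf v) C ≤ 1 ↔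
      ∀ y y', y ∉ Function.periodicPts f → y' ∉ Function.periodicPts f →
        y ∈ Set.range f → y' ∈ Set.range f → y = y' := by
  have hmem : ∀ x, x ∈ {x | x ∈ (graphOf v).vertexSet ∧ x ∉ vertexSupport (graphOf v) C ∧
      2 ≤ vertexDegree (graphOf v) x} ↔ x ∉ Function.periodicPts f ∧ x ∈ Set.range f := by
    intro x
    rw [Set.mem_ofPred_eq, hC]
    constructor
    · rintro ⟨-, h1, h2⟩
      exact ⟨h1, (two_le_vertexDegree_iff hσ h1).mp h2⟩
    · rintro ⟨h1, h2⟩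
      exact ⟨Set.mem_univ _, h1, (two_le_vertexDegree_iff hσ h1).mpr h2⟩
  rw [offCircuitBranching, Set.ncard_le_one]
  constructor
  · intro h y y' hy hy' hr hr'
    exact h y ((hmem y).mpr ⟨hy, hr⟩) y' ((hmem y').mpr ⟨hy', hr'⟩)
  · intro h y hy y' hy'
    obtain ⟨h1, h2⟩ := (hmem y).mp hy
    obtain ⟨h1', h2'⟩ := (hmem y').mp hy'
    exact h y y' h1 h1' h2 h2'

end Matching

end MonomialCremona

end

open MonomialCremona
theorem mainTheorem5 {k : Type*} [Field k] {n : ℕ} (hn : 2 ≤ n)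
    (v : Fin n → Fin n →₀ ℕ) (hv : IsCremonaSet k v 2) :
    ∃ (w : Fin n → Fin n →₀ ℕ) (r : ℕ) (C : Set (Fin n)),
      (IsCremonaInverse k v w ∧ ∀ w', IsCremonaInverse k v w' → w' = w) ∧
      (IsCircuit (graphOf v) r C ∧ ∀ r' C', IsCircuit (graphOf v) r' C' → r' = r ∧ C' = C) ∧
      List.TFAE [
        IsLinearType (Ideal.span (Set.range (monomials k w))),
        IsLinearlyPresented (monomials k v),
        (edgeGraph (graphOf v)).ediam ≤ 2,
        (r = 1 ∧ (∀ j ≥ 3, neighborhoodSize (graphOf v) C j = 0) ∧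
            offCircuitBranching (graphOf v) C ≤ 1) ∨
          (r = 3 ∧ ∀ j ≥ 2, neighborhoodSize (graphOf v) C j = 0) ∨
          (r = 5 ∧ ∀ j ≥ 1, neighborhoodSize (graphOf v) C j = 0)] := by
  have hd := hv.degree_eq
  have hinj := hv.injective
  have : Nonempty (Fin n) := ⟨⟨0, by omega⟩⟩
  obtain ⟨w, ⟨δ, hw⟩, hvw⟩ := hv.exists_isLeftInverse hn
  have hwv := hv.isLeftInverse_symm hn hvw
  obtain ⟨σ, f, hσ⟩ := exists_matching hd hv.det_ne_zero
  have hP : ∃ p, p ∈ Function.periodicPts f :=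
    ⟨_, (exists_iterate_mem_periodicPts f (Classical.arbitrary (Fin n))).choose_spec⟩
  obtain ⟨r, C, hC⟩ : ∃ r C, IsCircuit (graphOf v) r C :=
    ⟨_, _, isCircuit_of_mem_periodicPts hσ hP.choose_spec⟩
  have hu : ∀ r' C', IsCircuit (graphOf v) r' C' → r' = r ∧ C' = C :=
    fun r' C' h => hv.isCircuit_unique hC h
  have hodd : Odd r := (hC.exists_vecMul_eq fun z hz =>
    hv.vecMul_injective (hz.trans (Matrix.zero_vecMul _).symm)).1
  obtain ⟨hper, horb, hsupp⟩ := IsCircuit.eq_periodicPts hσ hu hP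
  refine ⟨w, r, C, ⟨⟨⟨δ, hw⟩, (compIsIdentity_monomials_iff k v w).mpr hvw,
    (compIsIdentity_monomials_iff k w v).mpr hwv⟩, fun w' hw' => ?_⟩, ⟨hC, hu⟩, ?_⟩
  · obtain ⟨δ', h'⟩ := hw'.stochastic
    exact hv.isLeftInverse_unique hvw ((compIsIdentity_monomials_iff k v w').mp hw'.left_inverse)
      hw.exists_eq_zero h'.exists_eq_zero
  · have h1 : IsLinearType (Ideal.span (Set.range (monomials k w))) ↔ IsGapFree v :=
      ⟨isGapFree_of_isLinearType hd hinj hw.degree_eq hvw hwv, fun h =>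
        h.isLinearType hd hinj hv.linearCombination_injective hw.degree_eq hvw hwv⟩
    have h2 : IsLinearlyPresented (monomials k v) ↔ IsGapFree v :=
      ⟨isGapFree_of_isLinearlyPresented hd hinj, fun h => h.isLinearlyPresented hd hinj⟩
    have h3 := ediam_edgeGraph_le_two_iff hd
    have h4 := (isGapFree_iff_isGapFreeMap hσ).trans (isGapFreeMap_iff hodd hper horb)
    rw [← neighborhoodSize_eq_zero_iff hσ hsupp 2, ← neighborhoodSize_eq_zero_iff hσ hsupp 1,
      ← neighborhoodSize_eq_zero_iff hσ hsupp 0, ← offCircuitBranching_le_one_iff hσ hsupp] at h4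
    tfae_have 1 ↔ 3 := h1.trans h3.symm
    tfae_have 2 ↔ 3 := h2.trans h3.symm
    tfae_have 3 ↔ 4 := h3.trans h4
    tfae_finish
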